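/- Let $\delta>0$ and $t_0\le T$ be real numbers and let $V(y)=\tfrac14(y^2-1)^2$, so $V'(y)=y^3-y$. Let $H_0^1=H_0^1(0,1)$ be the closure of $C_c^\infty(0,1)$ in the norm $(\|u\|_{L^2}^2+\|u_x\|_{L^2}^2)^{1/2}$, let $H^{-1}$ be its dual, and write $\langle\cdot,\cdot\rangle$ for the pairing between $H^{-1}$ and $H_0^1$, $(\cdot,\cdot)$ for the inner product of $L^2=L^2(0,1)$, and $L^4=L^4(0,1)$. Let $\varphi_0\in H_0^1$ and $\alpha\in L^2(t_0,T;L^2)$. Consider the controlled Ginzburg–Landau equation $$\varphi_t=\delta\varphi_{xx}-\delta^{-1}V'(\varphi)+\alpha,\qquad \varphi(t_0)=\varphi_0. \tag{1}$$ A function $\varphi\in C([t_0,T];H_0^1)$ is a weak solution of (1) if $\varphi\in L^2(t_0,T;H_0^1)$, its weak time derivative $\varphi_t$ exists and belongs to $L^2(t_0,T;H^{-1})$, for each $v\in H_0^1$ and almost every $t\in(t_0,T)$ $$\langle\varphi_t(t),v\rangle+\delta(\varphi_x(t),v_x)=(-\delta^{-1}V'(\varphi(t))+\alpha(t),v),$$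 and $\varphi(t_0)=\varphi_0$. Then there exists exactly one weak solution $\varphi$ of (1) in $C([t_0,T];H_0^1)$. This solution satisfies, for all $t\in[t_0,T]$, $$\|\varphi_x(t)\|_{L^2}^2\le\|(\varphi_0)_x\|_{L^2}^2+\frac{\delta^{-2}}{2}\|\varphi_0\|_{L^4}^4-\delta^{-2}\|\varphi_0\|_{L^2}^2+\delta^{-1}\|\alpha\|_{L^2(t_0,T;L^2)}^2+\frac{\delta^{-2}}{2}.$$ -/

import Mathlib

open MeasureTheory Set
open scoped ContDiff

noncomputable section

namespace GinzburgLandau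

/-- Smooth real functions on the line, compactly supported inside the open interval `(a, b)`. -/
structure IsTestFunction (a b : ℝ) (η : ℝ → ℝ) : Prop where
  smooth : ContDiff ℝ ∞ η
  compact : HasCompactSupport η
  supp : tsupport η ⊆ Ioo a b

/-- Lebesgue measure on the open interval `(a, b)`. -/
abbrev intervalMeasure (a b : ℝ) : Measure ℝ := volume.restrict (Ioo a b)

/-- The real Hilbert space `L²(0,1)`. -/
abbrev L2 : Type := Lp ℝ 2 (intervalMeasure 0 1)

/-- The pairs `(ψ, ψ')`, for `ψ` in `C_c^∞(0,1)`, as elements of the Hilbert space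
`L²(0,1) × L²(0,1)`; this set is a linear subspace. -/
def testPairs : Set (WithLp 2 (L2 × L2)) :=
  {p | ∃ ψ : ℝ → ℝ, IsTestFunction 0 1 ψ ∧
    (p.fst : ℝ → ℝ) =ᵐ[intervalMeasure 0 1] ψ ∧
    (p.snd : ℝ → ℝ) =ᵐ[intervalMeasure 0 1] deriv ψ}

/-- `H₀¹(0,1)` is the closure of `C_c^∞(0,1)` in the norm `(‖u‖² + ‖u_x‖²)^{1/2}`. An element `u`
is recorded as the pair `(u, u_x)`, where `u_x` is the weak derivative, which `u` determines. -/
def H01Subspace : Submodule ℝ (WithLp 2 (L2 × L2)) :=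
  (Submodule.span ℝ testPairs).topologicalClosure

/-- The Hilbert space `H₀¹(0,1)`, with the norm `(‖u‖² + ‖u_x‖²)^{1/2}`. -/
abbrev H01 : Type := ↥H01Subspace

instance : CompleteSpace H01 :=
  (Submodule.isClosed_topologicalClosure (Submodule.span ℝ testPairs)).completeSpace_coe

/-- The inclusion of `H₀¹(0,1)` in `L²(0,1)`. -/
def H01.val : H01 →L[ℝ] L2 :=
  (WithLp.fstL 2 ℝ L2 L2).comp H01Subspace.subtypeL

/-- The weak derivative `u ↦ u_x`. -/
def H01.dx : H01 →L[ℝ] L2 :=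
  (WithLp.sndL 2 ℝ L2 L2).comp H01Subspace.subtypeL

/-- `H⁻¹(0,1)`, the dual of `H₀¹(0,1)`; the pairing `⟨f, v⟩` is `f v`. -/
abbrev HNeg1 : Type := StrongDual ℝ H01

/-- The embedding of `H₀¹(0,1)` in `H⁻¹(0,1)` through `L²(0,1)`: `⟨u, v⟩ = ∫ u v dx`. -/
def H01.toHNeg1 (u : H01) : HNeg1 := (innerSL ℝ (H01.val u)).comp H01.val

/-- The space `L²(t₀,T;L²(0,1))` of controls. -/
abbrev Control (t₀ T : ℝ) : Type := Lp L2 2 (intervalMeasure t₀ T)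

/-- The double-well potential. -/
def V (y : ℝ) : ℝ := (1 / 4) * (y ^ 2 - 1) ^ 2

/-- `g` is the weak derivative in time on `(t₀, T)`, as an `H⁻¹`-valued function, of `φ`. -/
def HasWeakTimeDeriv (t₀ T : ℝ) (φ : ℝ → H01) (g : ℝ → HNeg1) : Prop :=
  ∀ η : ℝ → ℝ, IsTestFunction t₀ T η →
    ∫ t in Ioo t₀ T, deriv η t • (φ t).toHNeg1 = -∫ t in Ioo t₀ T, η t • g t

/-- `φ` is a weak solution on `[t₀, T]`, with Dirichlet boundary conditions on `(0,1)`, of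
`φ_t = δ φ_xx - δ⁻¹ V'(φ) + α`, `φ(t₀) = φ₀`. The initial condition is imposed on `φ` itself, so
this is to be used for a `φ` that is continuous on `[t₀, T]`. -/
def IsWeakSolution (δ t₀ T : ℝ) (α : Control t₀ T) (φ₀ : H01) (φ : ℝ → H01) : Prop :=
  MemLp φ 2 (intervalMeasure t₀ T) ∧
  (∃ φt : ℝ → HNeg1, MemLp φt 2 (intervalMeasure t₀ T) ∧ HasWeakTimeDeriv t₀ T φ φt ∧
    ∀ v : H01, ∀ᵐ t ∂(intervalMeasure t₀ T),
      φt t v + δ * inner ℝ (φ t).dx v.dx =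
        ∫ x in Ioo (0 : ℝ) 1, (-δ⁻¹ * deriv V ((φ t).val x) + α t x) * v.val x) ∧
  φ t₀ = φ₀

end GinzburgLandau

end

noncomputable section

namespace GinzburgLandau

/-! The estimate is the gradient-flow inequality: formally, testing the equation with `φ_t` shows
that `δ/2 ‖φ_x‖² + δ⁻¹ ∫ V(φ)` grows by at most `1/2 ∫ ‖α‖²`. Since `V ≥ 0`, this bounds `‖φ_x‖` by
data alone, and in one dimension `|φ| ≤ ‖φ_x‖` a.e. So the cubic force can be replaced by the
globally Lipschitz `truncForce M`: once `M` exceeds the a priori bound, the truncation is never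
active.

The linear problem `u_t = δ u_xx + f` is diagonal in the sine basis, and for paths continuous in
`H₀¹` being a weak solution is the same as `SolvesModes` (`SolvesModes.isWeakLinear`,
`IsWeakLinear.solvesModes`). Solving each mode and summing gives `exists_solvesModes`. With a
Lipschitz force, sending `u` to the linear solution driven by `u` is a Volterra map, and some
iterate of it contracts (`exists_unique_fixedPoint_of_volterra`, `exists_unique_truncated`).

The energy inequality is proved without a chain rule in Hilbert space. On a short interval `[s, t]`
the nonlinearity is frozen at time `s`: `SolvesModes.energy_le` with a constant shift handles the
linear part, and the second-order bound `potEnergy_sub_le` the potential. The error is at most `C (t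
- s) (J t - J s)` for one fixed function `J`, so it disappears after summing over finer and finer
partitions (`sub_le_sub_of_forall_sub_le`, `truncated_energy_le`).

For uniqueness, two weak solutions continuous into `H₀¹` are bounded there, so both solve a
truncated problem at a common level, whose solution is unique. -/

/-! ### Primitives of integrable functions and integration by parts. -/

lemma ac_of_eq_add_integral {a b : ℝ} (hab : a ≤ b) {f p : ℝ → ℝ}
    (hp : IntervalIntegrable p volume a b) (hf : ∀ x ∈ Icc a b, f x = f a + ∫ s in a..x, p s) :
    AbsolutelyContinuousOnInterval f a b ∧ ∀ᵐ x, x ∈ Ioo a b → deriv f x = p x := by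
  have h1 := hp.absolutelyContinuousOnInterval_intervalIntegral (c := a) (by simp)
  have h2 : AbsolutelyContinuousOnInterval (fun _ : ℝ => f a) a b :=
    (contDiffOn_const (n := 1)).absolutelyContinuousOnInterval
  have h3 := h2.add h1
  have heq : EqOn f ((fun _ : ℝ => f a) + fun x => ∫ s in a..x, p s) (Icc a b) := fun x hx => by
    simpa using hf x hx
  refine ⟨?_, ?_⟩
  · rw [absolutelyContinuousOnInterval_iff] at h3 ⊢
    intro ε hε
    obtain ⟨δ, hδ, h⟩ := h3 ε hε
    refine ⟨δ, hδ, fun E hE hE' => ?_⟩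
    refine lt_of_le_of_lt (le_of_eq ?_) (h E hE hE')
    refine Finset.sum_congr rfl fun i hi => ?_
    have := hE.1 i hi
    rw [uIcc_of_le hab] at this
    rw [heq this.1, heq this.2]
  · filter_upwards [hp.ae_hasDerivAt_integral] with x hx hx'
    have := (hx (by rw [uIcc_of_le hab]; exact Ioo_subset_Icc_self hx') a (by simp)).const_add (f a)
    refine HasDerivAt.deriv (this.congr_of_eventuallyEq ?_)
    filter_upwards [Icc_mem_nhds hx'.1 hx'.2] with y hy using hf y hy

/-- Integration by parts for primitives of integrable functions. -/
lemma integral_parts_of_eq_add_integral {a b : ℝ} (hab : a ≤ b) {f g p q : ℝ → ℝ}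
    (hp : IntervalIntegrable p volume a b) (hf : ∀ x ∈ Icc a b, f x = f a + ∫ s in a..x, p s)
    (hq : IntervalIntegrable q volume a b) (hg : ∀ x ∈ Icc a b, g x = g a + ∫ s in a..x, q s) :
    ∫ x in a..b, (p x * g x + f x * q x) = f b * g b - f a * g a := by
  obtain ⟨h1, h2⟩ := ac_of_eq_add_integral hab hp hf
  obtain ⟨h3, h4⟩ := ac_of_eq_add_integral hab hq hg
  rw [← h1.integral_deriv_mul_eq_sub h3]
  apply intervalIntegral.integral_congr_ae
  have h5 : ∀ᵐ x, x ≠ b := by simp [ae_iff, measure_singleton]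
  filter_upwards [h2, h4, h5] with x h2 h4 h5 hx
  rw [uIoc_of_le hab] at hx
  have : x ∈ Ioo a b := ⟨hx.1, lt_of_le_of_ne hx.2 h5⟩
  rw [h2 this, h4 this]

lemma eq_add_integral_deriv {g : ℝ → ℝ} (hg : ContDiff ℝ 1 g) (a x : ℝ) :
    g x = g a + ∫ s in a..x, deriv g s := by
  rw [intervalIntegral.integral_deriv_eq_sub]
  · ring
  · intro y _; exact hg.differentiable (by simp) y
  · exact (hg.continuous_deriv le_rfl).intervalIntegrable _ _

lemma integral_Ioo_eq_interval {E : Type*} [NormedAddCommGroup E] [NormedSpace ℝ E] {a b : ℝ} (hab : a ≤ b) (f : ℝ → E) :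
    ∫ x in Ioo a b, f x = ∫ x in a..b, f x := by
  rw [intervalIntegral.integral_of_le hab, integral_Ioc_eq_integral_Ioo]

lemma intervalIntegrable_of_integrable_Ioo {E : Type*} [NormedAddCommGroup E] {a b : ℝ} {f : ℝ → E}
    (h : Integrable f (intervalMeasure a b)) {s t : ℝ} (hs : s ∈ Icc a b) (ht : t ∈ Icc a b) :
    IntervalIntegrable f volume s t := by
  have h1 : IntegrableOn f (Icc a b) := integrableOn_Icc_iff_integrableOn_Ioo (by simp) (by simp) |>.2 h
  exact (intervalIntegrable_iff).2 (h1.mono_set (uIoc_subset_uIcc.trans (uIcc_subset_Icc hs ht)))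

/-! ### Test functions and weak derivatives on an interval. -/

lemma IsTestFunction.eq_zero_left {a b : ℝ} {η : ℝ → ℝ} (h : IsTestFunction a b η) : η a = 0 := by
  by_contra h0
  have := h.supp (subset_tsupport η h0)
  exact lt_irrefl _ this.1

lemma IsTestFunction.eq_zero_right {a b : ℝ} {η : ℝ → ℝ} (h : IsTestFunction a b η) : η b = 0 := by
  by_contra h0
  have := h.supp (subset_tsupport η h0)
  exact lt_irrefl _ this.2

/-- A primitive of an integrable function has that function as its weak derivative. -/
lemma integral_deriv_test_mul {a b : ℝ} (hab : a ≤ b) {y g η : ℝ → ℝ} (hη : IsTestFunction a b η)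
    (hg : Integrable g (intervalMeasure a b)) (hy : ∀ x ∈ Icc a b, y x = y a + ∫ s in a..x, g s) :
    ∫ t in Ioo a b, deriv η t * y t = -∫ t in Ioo a b, η t * g t := by
  have h1 : ContDiff ℝ 1 η := hη.smooth.of_le (by exact_mod_cast le_top)
  have hgi := intervalIntegrable_of_integrable_Ioo hg (left_mem_Icc.2 hab) (right_mem_Icc.2 hab)
  have hd : IntervalIntegrable (deriv η) volume a b :=
    (h1.continuous_deriv le_rfl).intervalIntegrable _ _
  have := integral_parts_of_eq_add_integral hab hd (fun x _ => eq_add_integral_deriv h1 a x) hgi hy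
  rw [hη.eq_zero_left, hη.eq_zero_right] at this
  rw [integral_Ioo_eq_interval hab, integral_Ioo_eq_interval hab]
  have hyc : ContinuousOn y (uIcc a b) := (ac_of_eq_add_integral hab hgi hy).1.continuousOn
  rw [intervalIntegral.integral_add (hd.mul_continuousOn hyc) (hgi.continuousOn_mul h1.continuous.continuousOn)] at this
  linarith

/-- A test function of mean zero is the derivative of a test function. -/
lemma IsTestFunction.exists_primitive {a b : ℝ} (hab : a < b) {θ : ℝ → ℝ} (hθ : IsTestFunction a b θ)
    (h0 : ∫ x in a..b, θ x = 0) : ∃ η, IsTestFunction a b η ∧ deriv η = θ := by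
  have hsub : tsupport θ ⊆ Ioo a b := hθ.supp
  obtain ⟨c, d, hac, hdb, hcd, hs⟩ : ∃ c d, a < c ∧ d < b ∧ c ≤ d ∧ tsupport θ ⊆ Icc c d := by
    rcases (tsupport θ).eq_empty_or_nonempty with he | hne
    · exact ⟨(a + b) / 2, (a + b) / 2, by linarith, by linarith, le_rfl, by simp [he]⟩
    · obtain ⟨c, hc, hc'⟩ := hθ.compact.isCompact.exists_isLeast hne
      obtain ⟨d, hd, hd'⟩ := hθ.compact.isCompact.exists_isGreatest hne
      exact ⟨c, d, (hsub hc).1, (hsub hd).2, hc' hd, fun x hx => ⟨hc' hx, hd' hx⟩⟩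
  have hcont := hθ.smooth.continuous
  have hz : ∀ x, x ∉ Icc c d → θ x = 0 := fun x hx => by
    by_contra h; exact hx (hs (subset_tsupport θ h))
  set η : ℝ → ℝ := fun x => ∫ s in a..x, θ s with hη
  have hd : ∀ x, HasDerivAt η (θ x) x := fun x =>
    intervalIntegral.integral_hasDerivAt_right (hcont.intervalIntegrable _ _)
      (hcont.stronglyMeasurableAtFilter _ _) hcont.continuousAt
  have hder : deriv η = θ := funext fun x => (hd x).deriv
  have hleft : ∀ x, x < c → η x = 0 := fun x hx => by
    refine intervalIntegral.integral_zero_ae (Filter.Eventually.of_forall fun s hs' => hz s fun h => ?_)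
    rcases le_total a x with h' | h'
    · rw [uIoc_of_le h'] at hs'; linarith [hs'.2, h.1]
    · rw [uIoc_of_ge h'] at hs'; linarith [hs'.2, h.1]
  -- The mean-zero hypothesis is used here: it makes the primitive vanish again to the right of the
  -- support.
  have hright : ∀ x, d < x → η x = 0 := fun x hx => by
    have : η x = (∫ s in a..b, θ s) + ∫ s in b..x, θ s :=
      (intervalIntegral.integral_add_adjacent_intervals (hcont.intervalIntegrable _ _)
        (hcont.intervalIntegrable _ _)).symm
    rw [this, h0, zero_add]
    refine intervalIntegral.integral_zero_ae (Filter.Eventually.of_forall fun s hs' => hz s fun h => ?_)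
    rcases le_total b x with h' | h'
    · rw [uIoc_of_le h'] at hs'; linarith [hs'.1, h.2]
    · rw [uIoc_of_ge h'] at hs'; linarith [hs'.1, h.2]
  have hsupp : tsupport η ⊆ Icc c d := by
    refine closure_minimal (fun x hx => ?_) isClosed_Icc
    by_contra h
    rw [mem_Icc, not_and_or, not_le, not_le] at h
    exact hx (h.elim (hleft x) (hright x))
  refine ⟨η, ⟨?_, ?_, hsupp.trans fun x hx => ⟨by linarith [hx.1], by linarith [hx.2]⟩⟩, hder⟩
  · rw [contDiff_infty_iff_deriv]
    exact ⟨fun x => (hd x).differentiableAt, hder ▸ hθ.smooth⟩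
  · exact HasCompactSupport.of_support_subset_isCompact isCompact_Icc ((subset_tsupport η).trans hsupp)

lemma exists_test_integral_one {a b : ℝ} (hab : a < b) :
    ∃ θ, IsTestFunction a b θ ∧ ∫ x in a..b, θ x = 1 := by
  let f : ContDiffBump ((a + b) / 2) := ⟨(b - a) / 8, (b - a) / 4, by linarith, by linarith⟩
  have hs : tsupport f ⊆ Ioo a b := by
    rw [f.tsupport_eq]
    intro x hx
    rw [Metric.mem_closedBall, Real.dist_eq, abs_le] at hx
    simp only [f] at hx
    exact ⟨by linarith [hx.1], by linarith [hx.2]⟩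
  refine ⟨f.normed volume, ⟨f.contDiff_normed, f.hasCompactSupport_normed, ?_⟩, ?_⟩
  · rwa [f.tsupport_normed_eq, ← f.tsupport_eq]
  · rw [← f.integral_normed (μ := volume), ← integral_Ioo_eq_interval hab.le]
    refine setIntegral_eq_integral_of_forall_compl_eq_zero fun x hx => ?_
    by_contra h
    refine hx (hs ?_)
    rw [f.tsupport_eq, ← f.tsupport_normed_eq (μ := volume)]
    exact subset_tsupport _ h

lemma IsTestFunction.add {a b : ℝ} {η θ : ℝ → ℝ} (hη : IsTestFunction a b η)
    (hθ : IsTestFunction a b θ) : IsTestFunction a b (η + θ) :=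
  ⟨hη.smooth.add hθ.smooth, hη.compact.add hθ.compact,
    (closure_mono (Function.support_add _ _)).trans
      (closure_union.subset.trans (union_subset hη.supp hθ.supp))⟩

lemma IsTestFunction.const_smul {a b : ℝ} {η : ℝ → ℝ} (hη : IsTestFunction a b η) (c : ℝ) :
    IsTestFunction a b (c • η) :=
  ⟨hη.smooth.const_smul c, hη.compact.smul_left (f := fun _ => c),
    (closure_mono (Function.support_const_smul_subset c η)).trans hη.supp⟩

/-- A function whose weak derivative vanishes is constant. -/
lemma ae_const_of_integral_deriv_test {a b : ℝ} (hab : a < b) {f : ℝ → ℝ}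
    (hf : Integrable f (intervalMeasure a b))
    (h : ∀ η, IsTestFunction a b η → ∫ t in Ioo a b, deriv η t * f t = 0) :
    ∃ c, f =ᵐ[intervalMeasure a b] fun _ => c := by
  obtain ⟨θ₀, h₀, h1⟩ := exists_test_integral_one hab
  have hint : ∀ θ : ℝ → ℝ, IsTestFunction a b θ → ∀ k : ℝ → ℝ, Integrable k (intervalMeasure a b) →
      Integrable (fun x => θ x * k x) (intervalMeasure a b) := fun θ hθ k hk => by
    obtain ⟨C, hC⟩ := hθ.compact.exists_bound_of_continuous hθ.smooth.continuous
    exact hk.bdd_mul hθ.smooth.continuous.aestronglyMeasurable (c := C)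
      (Filter.Eventually.of_forall hC)
  set c : ℝ := ∫ x in Ioo a b, θ₀ x * f x
  have hc : Integrable (fun _ : ℝ => c) (intervalMeasure a b) := integrable_const _
  refine ⟨c, ?_⟩
  have key : ∀ᵐ x, x ∈ Ioo a b → f x - c = 0 := by
    refine isOpen_Ioo.ae_eq_zero_of_integral_contDiff_smul_eq_zero
      (IntegrableOn.locallyIntegrableOn (hf.sub hc)) fun θ hθ1 hθ2 hθ3 => ?_
    have hθ : IsTestFunction a b θ := ⟨hθ1, hθ2, hθ3⟩
    set m : ℝ := ∫ x in a..b, θ x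
    -- Subtracting `m θ₀` removes the mean, so the remainder is the derivative of a test function
    -- and is annihilated by `f`. Hence `∫ θ f = m ∫ θ₀ f = c ∫ θ`.
    have ht : IsTestFunction a b (θ + (-m) • θ₀) := hθ.add (h₀.const_smul _)
    have hθi : ∀ θ : ℝ → ℝ, IsTestFunction a b θ → IntervalIntegrable θ volume a b :=
      fun θ hθ => hθ.smooth.continuous.intervalIntegrable _ _
    have h0 : ∫ x in a..b, (θ + (-m) • θ₀) x = 0 := by
      simp only [Pi.add_apply, Pi.smul_apply, smul_eq_mul]
      rw [intervalIntegral.integral_add (hθi _ hθ) ((hθi _ h₀).const_mul _),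
        intervalIntegral.integral_const_mul, h1]
      ring
    obtain ⟨η, hη, hd⟩ := ht.exists_primitive hab h0
    have h2 := h η hη
    rw [hd] at h2
    simp only [Pi.add_apply, Pi.smul_apply, smul_eq_mul] at h2
    have h3 : ∫ x in Ioo a b, (θ x * f x + (-m) * (θ₀ x * f x)) = 0 := by
      rw [← h2]; congr 1; ext x; ring
    rw [integral_add (hint θ hθ f hf) ((hint θ₀ h₀ f hf).const_mul _), integral_const_mul] at h3
    have h4 : ∫ x, θ x • (f x - c) = ∫ x in Ioo a b, θ x * f x - c * θ x := by
      rw [← setIntegral_eq_integral_of_forall_compl_eq_zero (s := Ioo a b)]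
      · congr 1; ext x; simp; ring
      · intro x hx
        have : θ x = 0 := by by_contra h'; exact hx (hθ3 (subset_tsupport θ h'))
        simp [this]
    rw [h4, integral_sub (hint θ hθ f hf), integral_const_mul, integral_Ioo_eq_interval hab.le θ]
    · change _ - c * m = 0
      linarith
    · have := (hint θ hθ _ (integrable_const (1:ℝ))).const_mul c
      simpa using this
  filter_upwards [(ae_restrict_iff' measurableSet_Ioo).2 key] with x hx
  linarith

lemma ae_eq_const_add_integral_of_weak {a b : ℝ} (hab : a < b) {y g : ℝ → ℝ}
    (hy : Integrable y (intervalMeasure a b)) (hg : Integrable g (intervalMeasure a b))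
    (h : ∀ η, IsTestFunction a b η →
      ∫ t in Ioo a b, deriv η t * y t = -∫ t in Ioo a b, η t * g t) :
    ∃ c, y =ᵐ[intervalMeasure a b] fun x => c + ∫ s in a..x, g s := by
  have hgi := intervalIntegrable_of_integrable_Ioo hg (left_mem_Icc.2 hab.le) (right_mem_Icc.2 hab.le)
  set P : ℝ → ℝ := fun x => ∫ s in a..x, g s
  have hP : ∀ x ∈ Icc a b, P x = P a + ∫ s in a..x, g s := fun x _ => by simp [P]
  have hPc : ContinuousOn P (Icc a b) := by
    have := (ac_of_eq_add_integral hab.le hgi hP).1.continuousOn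
    rwa [uIcc_of_le hab.le] at this
  have hPi : Integrable P (intervalMeasure a b) :=
    (hPc.integrableOn_Icc).mono_set Ioo_subset_Icc_self
  obtain ⟨c, hc⟩ := ae_const_of_integral_deriv_test hab (hy.sub hPi) fun η hη => by
    have h1 := h η hη
    have h2 := integral_deriv_test_mul hab.le hη hg hP
    have hd : Continuous (deriv η) := hη.smooth.continuous_deriv (by exact_mod_cast le_top)
    have hint : ∀ k : ℝ → ℝ, Integrable k (intervalMeasure a b) →
        Integrable (fun x => deriv η x * k x) (intervalMeasure a b) := fun k hk => by
      obtain ⟨C, hC⟩ := hη.compact.deriv.exists_bound_of_continuous hd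
      exact hk.bdd_mul hd.aestronglyMeasurable (c := C) (Filter.Eventually.of_forall hC)
    simp only [Pi.sub_apply, mul_sub]
    rw [integral_sub (hint _ hy) (hint _ hPi), h1, h2, sub_self]
  refine ⟨c, ?_⟩
  filter_upwards [hc] with x hx
  simp only [Pi.sub_apply] at hx
  linarith

/-- The a.e. identity becomes pointwise because both sides are continuous on the closed interval;
evaluating at `a` identifies the constant. -/
lemma eq_add_integral_of_weak {a b : ℝ} (hab : a < b) {y g : ℝ → ℝ}
    (hy : ContinuousOn y (Icc a b)) (hg : Integrable g (intervalMeasure a b))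
    (h : ∀ η, IsTestFunction a b η →
      ∫ t in Ioo a b, deriv η t * y t = -∫ t in Ioo a b, η t * g t) :
    ∀ t ∈ Icc a b, y t = y a + ∫ s in a..t, g s := by
  obtain ⟨c, hc⟩ := ae_eq_const_add_integral_of_weak hab
    (hy.integrableOn_Icc.mono_set Ioo_subset_Icc_self) hg h
  have hgi := intervalIntegrable_of_integrable_Ioo hg (left_mem_Icc.2 hab.le) (right_mem_Icc.2 hab.le)
  have hPc : ContinuousOn (fun x => ∫ s in a..x, g s) (Icc a b) := by
    have := (ac_of_eq_add_integral hab.le (f := fun x => ∫ s in a..x, g s) hgi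
      (fun x _ => by simp)).1.continuousOn
    rwa [uIcc_of_le hab.le] at this
  have h1 : EqOn y (fun x => c + ∫ s in a..x, g s) (Icc a b) := by
    have hc' : y =ᵐ[volume.restrict (Icc a b)] fun x => c + ∫ s in a..x, g s := by
      rwa [intervalMeasure, restrict_Ioo_eq_restrict_Icc] at hc
    exact Measure.eqOn_Icc_of_ae_eq volume hab.ne hc' hy (continuousOn_const.add hPc)
  intro t ht
  rw [h1 ht, h1 (left_mem_Icc.2 hab.le)]
  simp

/-! ### The spaces `L²(0,1)` and `H₀¹(0,1)`. -/

lemma inner_L2_eq (f g : L2) : inner ℝ f g = ∫ x in Ioo (0:ℝ) 1, f x * g x := by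
  rw [L2.inner_def]
  simp [mul_comm]

lemma memLp_of_continuous {g : ℝ → ℝ} (hg : Continuous g) : MemLp g 2 (intervalMeasure 0 1) := by
  obtain ⟨C, hC⟩ := (isCompact_Icc (a := (0:ℝ)) (b := 1)).exists_bound_of_continuousOn hg.continuousOn
  refine MemLp.of_bound hg.aestronglyMeasurable C ?_
  filter_upwards [ae_restrict_mem measurableSet_Ioo] with x hx using hC x (Ioo_subset_Icc_self hx)

/-- The class in `L²(0,1)` of a continuous function. -/
def contL2 (g : ℝ → ℝ) (hg : Continuous g) : L2 := (memLp_of_continuous hg).toLp g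

lemma coeFn_contL2 (g : ℝ → ℝ) (hg : Continuous g) : contL2 g hg =ᵐ[intervalMeasure 0 1] g :=
  MemLp.coeFn_toLp _

lemma inner_contL2 {g : ℝ → ℝ} (hg : Continuous g) (f : L2) :
    inner ℝ (contL2 g hg) f = ∫ x in (0:ℝ)..1, g x * f x := by
  rw [inner_L2_eq, ← integral_Ioo_eq_interval zero_le_one]
  refine integral_congr_ae ?_
  filter_upwards [coeFn_contL2 g hg] with x hx
  rw [hx]

lemma integrable_coeFn (f : L2) : Integrable f (intervalMeasure 0 1) :=
  (Lp.memLp f).integrable (by norm_num)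

/-- Test pairs already form a subspace, so every element of `H₀¹` is a limit of genuine test pairs
and not merely of linear combinations. -/
lemma coe_span_testPairs : (Submodule.span ℝ testPairs : Set (WithLp 2 (L2 × L2))) = testPairs := by
  let S : Submodule ℝ (WithLp 2 (L2 × L2)) :=
    { carrier := testPairs
      zero_mem' := by
        refine ⟨0, ⟨contDiff_const, HasCompactSupport.zero, by simp [tsupport]⟩, ?_, ?_⟩
        · exact Lp.coeFn_zero _ _ _
        · have : deriv (0 : ℝ → ℝ) = 0 := by ext x; simp
          rw [this]
          exact Lp.coeFn_zero _ _ _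
      add_mem' := by
        rintro p q ⟨ψ, hψ, h1, h2⟩ ⟨θ, hθ, h3, h4⟩
        refine ⟨ψ + θ, hψ.add hθ, ?_, ?_⟩
        · exact (Lp.coeFn_add p.fst q.fst).trans (h1.add h3)
        · have : deriv (ψ + θ) = deriv ψ + deriv θ := by
            ext x
            exact deriv_add (hψ.smooth.differentiable (by simp) x)
              (hθ.smooth.differentiable (by simp) x)
          rw [this]
          exact (Lp.coeFn_add p.snd q.snd).trans (h2.add h4)
      smul_mem' := by
        rintro c p ⟨ψ, hψ, h1, h2⟩
        refine ⟨c • ψ, hψ.const_smul c, ?_, ?_⟩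
        · exact (Lp.coeFn_smul c p.fst).trans (h1.const_smul c)
        · have : deriv (c • ψ) = c • deriv ψ := by
            ext x
            exact deriv_const_smul c (hψ.smooth.differentiable (by simp) x)
          rw [this]
          exact (Lp.coeFn_smul c p.snd).trans (h2.const_smul c) }
  exact congrArg SetLike.coe (Submodule.span_eq S)

lemma H01.norm_sq (v : H01) : ‖v‖ ^ 2 = ‖v.val‖ ^ 2 + ‖v.dx‖ ^ 2 :=
  WithLp.prod_norm_sq_eq_of_L2 _

lemma H01.inner_eq (v w : H01) : inner ℝ v w = inner ℝ v.val w.val + inner ℝ v.dx w.dx :=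
  WithLp.prod_inner_apply _ _

lemma H01.ext_val_dx {v w : H01} (h1 : v.val = w.val) (h2 : v.dx = w.dx) : v = w := by
  rw [← sub_eq_zero, ← norm_eq_zero, ← sq_eq_zero_iff, H01.norm_sq, map_sub, map_sub, h1, h2]
  simp

/-- Integration by parts in `H₀¹`. -/
lemma H01.inner_deriv_val {g : ℝ → ℝ} (hg : ContDiff ℝ 1 g) (v : H01) :
    inner ℝ (contL2 (deriv g) (hg.continuous_deriv le_rfl)) v.val =
      -inner ℝ (contL2 g hg.continuous) v.dx := by
  -- The defect in the formula is a continuous functional vanishing on test pairs, hence on their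
  -- closure. No boundary condition on `g` is needed, since the test functions vanish at the ends.
  set A : WithLp 2 (L2 × L2) →L[ℝ] ℝ :=
    (innerSL ℝ (contL2 (deriv g) (hg.continuous_deriv le_rfl))).comp (WithLp.fstL 2 ℝ L2 L2)
      + (innerSL ℝ (contL2 g hg.continuous)).comp (WithLp.sndL 2 ℝ L2 L2) with hA
  have h1 : Submodule.span ℝ testPairs ≤ A.ker := by
    rw [Submodule.span_le]
    rintro p ⟨ψ, hψ, h1, h2⟩
    change inner ℝ (contL2 (deriv g) _) p.fst + inner ℝ (contL2 g _) p.snd = 0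
    rw [inner_contL2, inner_contL2, ← integral_Ioo_eq_interval zero_le_one,
      ← integral_Ioo_eq_interval zero_le_one]
    have e1 : ∫ x in Ioo (0:ℝ) 1, deriv g x * p.fst x = ∫ x in Ioo (0:ℝ) 1, ψ x * deriv g x :=
      integral_congr_ae (by filter_upwards [h1] with x hx; rw [hx, mul_comm])
    have e2 : ∫ x in Ioo (0:ℝ) 1, g x * p.snd x = ∫ x in Ioo (0:ℝ) 1, deriv ψ x * g x :=
      integral_congr_ae (by filter_upwards [h2] with x hx; rw [hx, mul_comm])
    have hgc := hg.continuous_deriv le_rfl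
    rw [e1, e2, integral_deriv_test_mul zero_le_one hψ (g := deriv g)
      (hgc.integrableOn_Icc.mono_set Ioo_subset_Icc_self) (fun x _ => eq_add_integral_deriv hg 0 x)]
    ring
  have h2 : H01Subspace ≤ A.ker :=
    Submodule.topologicalClosure_minimal _ h1 A.isClosed_ker
  have h3 : A (v : WithLp 2 (L2 × L2)) = 0 := h2 v.2
  change inner ℝ (contL2 (deriv g) _) v.val + inner ℝ (contL2 g _) v.dx = 0 at h3
  linarith

/-- The weak derivative is determined by the function: if `v.val = 0`, integration by parts makes
`v.dx` orthogonal to every test function. -/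
lemma H01.val_injective {v : H01} (h : v.val = 0) : v = 0 := by
  refine H01.ext_val_dx (by simpa using h) ?_
  rw [map_zero]
  have key : ∀ᵐ x, x ∈ Ioo (0:ℝ) 1 → v.dx x = 0 := by
    refine isOpen_Ioo.ae_eq_zero_of_integral_contDiff_smul_eq_zero
      (IntegrableOn.locallyIntegrableOn (integrable_coeFn v.dx)) fun g h1 h2 h3 => ?_
    have h4 : ContDiff ℝ 1 g := h1.of_le (by exact_mod_cast le_top)
    have h5 := H01.inner_deriv_val h4 v
    rw [h, inner_zero_right, inner_contL2, ← integral_Ioo_eq_interval zero_le_one] at h5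
    rw [← setIntegral_eq_integral_of_forall_compl_eq_zero (s := Ioo (0:ℝ) 1)]
    · simp only [smul_eq_mul]; linarith
    · intro x hx
      have : g x = 0 := by by_contra h'; exact hx (h3 (subset_tsupport g h'))
      simp [this]
  rw [Lp.eq_zero_iff_ae_eq_zero]
  exact (ae_restrict_iff' measurableSet_Ioo).2 key

/-- `ψ x` is the integral of `ψ'` over `(0, x)`, that is, the pairing of `ψ'` with an indicator of
norm at most one; Cauchy–Schwarz concludes. -/
lemma abs_le_norm_of_isTestFunction {ψ : ℝ → ℝ} (hψ : IsTestFunction 0 1 ψ) {q : L2}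
    (hq : q =ᵐ[intervalMeasure 0 1] deriv ψ) {x : ℝ} (hx : x ∈ Ioo (0:ℝ) 1) : |ψ x| ≤ ‖q‖ := by
  have h1 : ContDiff ℝ 1 ψ := hψ.smooth.of_le (by exact_mod_cast le_top)
  have hfin : (intervalMeasure 0 1) (Ioo 0 x) ≠ ⊤ := measure_ne_top _ _
  have h2 : ψ x = inner ℝ (indicatorConstLp 2 (μ := intervalMeasure 0 1) measurableSet_Ioo hfin (1:ℝ)) q := by
    rw [L2.inner_indicatorConstLp_one, eq_add_integral_deriv h1 0 x, hψ.eq_zero_left, zero_add,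
      Measure.restrict_restrict measurableSet_Ioo,
      inter_eq_left.2 (Ioo_subset_Ioo_right hx.2.le), ← integral_Ioo_eq_interval hx.1.le]
    refine integral_congr_ae ?_
    have hq' : q =ᵐ[volume.restrict (Ioo 0 x)] deriv ψ :=
      ae_restrict_of_ae_restrict_of_subset (Ioo_subset_Ioo_right hx.2.le) hq
    exact hq'.symm
  rw [h2]
  refine (abs_real_inner_le_norm _ _).trans ?_
  rw [norm_indicatorConstLp (by norm_num) (by norm_num)]
  have h3 : (intervalMeasure 0 1).real (Ioo 0 x) ≤ 1 := by
    refine (measureReal_mono (subset_univ _)).trans ?_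
    simp [Measure.real]
  have h4 : (intervalMeasure 0 1).real (Ioo 0 x) ^ (1 / (2 : ENNReal).toReal) ≤ 1 :=
    Real.rpow_le_one measureReal_nonneg h3 (by positivity)
  rw [norm_one, one_mul]
  exact mul_le_of_le_one_left (norm_nonneg _) h4

/-- The embedding of `H₀¹(0,1)` in `L^∞(0,1)`. -/
lemma H01.ae_abs_val_le (v : H01) : ∀ᵐ x ∂(intervalMeasure 0 1), |v.val x| ≤ ‖v.dx‖ := by
  have hv : (v : WithLp 2 (L2 × L2)) ∈ closure testPairs := by
    rw [← coe_span_testPairs]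
    exact v.2
  obtain ⟨p, hp, hlim⟩ := mem_closure_iff_seq_limit.1 hv
  have h1 : Filter.Tendsto (fun n => (p n).fst) Filter.atTop (nhds v.val) :=
    ((WithLp.fstL 2 ℝ L2 L2).continuous.tendsto _).comp hlim
  have h2 : Filter.Tendsto (fun n => (p n).snd) Filter.atTop (nhds v.dx) :=
    ((WithLp.sndL 2 ℝ L2 L2).continuous.tendsto _).comp hlim
  obtain ⟨ns, hns, hae⟩ := (tendstoInMeasure_of_tendsto_Lp h1).exists_seq_tendsto_ae
  have h3 : ∀ n, ∀ᵐ x ∂(intervalMeasure 0 1), |(p n).fst x| ≤ ‖(p n).snd‖ := fun n => by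
    obtain ⟨ψ, hψ, e1, e2⟩ := hp n
    filter_upwards [e1, ae_restrict_mem measurableSet_Ioo] with x hx hx'
    rw [hx]
    exact abs_le_norm_of_isTestFunction hψ e2 hx'
  filter_upwards [hae, ae_all_iff.2 h3] with x hx hx'
  exact le_of_tendsto_of_tendsto hx.abs ((h2.norm).comp hns.tendsto_atTop)
    (Filter.Eventually.of_forall fun i => hx' (ns i))

lemma H01.norm_val_le (v : H01) : ‖v.val‖ ≤ ‖v.dx‖ := by
  have := Lp.norm_le_of_ae_bound (f := v.val) (C := ‖v.dx‖) (norm_nonneg _) v.ae_abs_val_le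
  have h2 : measureUnivNNReal (intervalMeasure 0 1) = 1 := by
    simp [measureUnivNNReal]
  simpa [h2] using this

/-- A `C¹` function vanishing at `0` and `1` is in `H₀¹(0,1)`. -/
lemma mem_H01Subspace_of_contDiff {s : ℝ → ℝ} (hs : ContDiff ℝ 1 s) (h0 : s 0 = 0) (h1 : s 1 = 0) :
    WithLp.toLp 2 (contL2 s hs.continuous, contL2 (deriv s) (hs.continuous_deriv le_rfl)) ∈
      H01Subspace := by
  -- By double orthogonality no approximating sequence is needed. If `q` is orthogonal to all test
  -- pairs, then `q.fst` is the weak derivative of `q.snd`, so the pairing of `q` with `(s, s')` is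
  -- a boundary term, which vanishes.
  rw [H01Subspace, ← Submodule.orthogonal_orthogonal_eq_closure, Submodule.mem_orthogonal]
  intro q hq
  rw [Submodule.mem_orthogonal] at hq
  have hs' := hs.continuous_deriv le_rfl
  have hint : ∀ {k : ℝ → ℝ}, Continuous k → ∀ f : L2, Integrable (fun x => k x * f x) (intervalMeasure 0 1) :=
    fun hk f => (memLp_of_continuous hk).integrable_mul (Lp.memLp f)
  set P : ℝ → ℝ := fun x => ∫ t in (0:ℝ)..x, q.fst t with hP
  obtain ⟨c, hc⟩ := ae_eq_const_add_integral_of_weak (y := q.snd) zero_lt_one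
    (integrable_coeFn q.snd) (integrable_coeFn q.fst) fun η hη => by
      have hη1 : ContDiff ℝ 1 η := hη.smooth.of_le (by exact_mod_cast le_top)
      have := hq (WithLp.toLp 2 (contL2 η hη1.continuous, contL2 (deriv η) (hη1.continuous_deriv le_rfl)))
        (Submodule.subset_span ⟨η, hη, coeFn_contL2 η hη1.continuous, coeFn_contL2 (deriv η) (hη1.continuous_deriv le_rfl)⟩)
      rw [WithLp.prod_inner_apply] at this
      change inner ℝ (contL2 η hη1.continuous) q.fst +
        inner ℝ (contL2 (deriv η) (hη1.continuous_deriv le_rfl)) q.snd = 0 at this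
      rw [inner_contL2, inner_contL2, ← integral_Ioo_eq_interval zero_le_one,
        ← integral_Ioo_eq_interval zero_le_one] at this
      linarith
  rw [real_inner_comm, WithLp.prod_inner_apply]
  change inner ℝ (contL2 s hs.continuous) q.fst + inner ℝ (contL2 (deriv s) hs') q.snd = 0
  rw [inner_contL2, inner_contL2, ← integral_Ioo_eq_interval zero_le_one,
        ← integral_Ioo_eq_interval zero_le_one]
  have e : ∫ x in Ioo (0:ℝ) 1, deriv s x * q.snd x = ∫ x in Ioo (0:ℝ) 1, deriv s x * (c + P x) :=
    integral_congr_ae (by filter_upwards [hc] with x hx; rw [hx])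
  have hqi := intervalIntegrable_of_integrable_Ioo (integrable_coeFn q.fst)
    (left_mem_Icc.2 zero_le_one) (right_mem_Icc.2 zero_le_one)
  have hPc := integral_parts_of_eq_add_integral (g := fun x => c + P x) zero_le_one
    (hs'.intervalIntegrable (μ := volume) 0 1) (fun x _ => eq_add_integral_deriv hs 0 x) hqi
    (fun x hx => by simp [hP])
  rw [h0, h1, zero_mul, zero_mul, sub_zero, ← integral_Ioo_eq_interval zero_le_one,
    integral_add _ (hint hs.continuous _)] at hPc
  · rw [e, add_comm]; exact hPc
  · refine (hint hs' q.snd).congr ?_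
    filter_upwards [hc] with x hx
    rw [hx]

/-! ### The sine basis of `L²(0,1)` and of `H₀¹(0,1)`. -/

/-- The frequencies of the Dirichlet eigenfunctions on `(0,1)`. -/
def freq (n : ℕ) : ℝ := (n + 1) * Real.pi

/-- The Dirichlet eigenvalues of `-d²/dx²` on `(0,1)`. -/
def eigval (n : ℕ) : ℝ := freq n ^ 2

lemma freq_pos (n : ℕ) : 0 < freq n := by unfold freq; positivity

lemma eigval_pos (n : ℕ) : 0 < eigval n := pow_pos (freq_pos n) 2

lemma eigval_injective : Function.Injective eigval := by
  intro m n h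
  have h1 := (pow_left_inj₀ (freq_pos m).le (freq_pos n).le two_ne_zero).1 h
  have h2 := mul_right_cancel₀ Real.pi_pos.ne' h1
  exact_mod_cast add_right_cancel h2

/-- The normalised Dirichlet eigenfunctions on `(0,1)`. -/
def sineFun (n : ℕ) (x : ℝ) : ℝ := √2 * Real.sin (freq n * x)

lemma contDiff_sineFun (n : ℕ) : ContDiff ℝ 2 (sineFun n) := by
  unfold sineFun; fun_prop

lemma deriv_sineFun (n : ℕ) : deriv (sineFun n) = fun x => √2 * freq n * Real.cos (freq n * x) := by
  ext x
  have h : HasDerivAt (sineFun n) (√2 * (Real.cos (freq n * x) * (freq n * 1))) x :=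
    (((hasDerivAt_id x).const_mul (freq n)).sin).const_mul _
  rw [h.deriv]; ring

lemma contDiff_deriv_sineFun (n : ℕ) : ContDiff ℝ 1 (deriv (sineFun n)) := by
  rw [deriv_sineFun]; fun_prop

lemma deriv_deriv_sineFun (n : ℕ) : deriv (deriv (sineFun n)) = fun x => -eigval n * sineFun n x := by
  rw [deriv_sineFun]
  ext x
  have h : HasDerivAt (fun x => √2 * freq n * Real.cos (freq n * x))
      (√2 * freq n * (-Real.sin (freq n * x) * (freq n * 1))) x :=
    (((hasDerivAt_id x).const_mul (freq n)).cos).const_mul _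
  rw [h.deriv, sineFun, eigval]; ring

lemma sin_freq (n : ℕ) : Real.sin (freq n) = 0 := by
  have := Real.sin_nat_mul_pi (n + 1)
  rwa [Nat.cast_add, Nat.cast_one] at this

lemma contDiff_one_sineFun (n : ℕ) : ContDiff ℝ 1 (sineFun n) :=
  (contDiff_sineFun n).of_le (by norm_num)

/-- The Dirichlet eigenfunctions as elements of `H₀¹(0,1)`. -/
def sineH (n : ℕ) : H01 :=
  ⟨_, mem_H01Subspace_of_contDiff (contDiff_one_sineFun n) (by simp [sineFun])
    (by simp [sineFun, sin_freq])⟩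

/-- The Dirichlet eigenfunctions as elements of `L²(0,1)`. -/
def sineL2 (n : ℕ) : L2 := contL2 (sineFun n) (contDiff_one_sineFun n).continuous

lemma val_sineH (n : ℕ) : (sineH n).val = sineL2 n := rfl

lemma dx_sineH (n : ℕ) :
    (sineH n).dx = contL2 (deriv (sineFun n)) ((contDiff_one_sineFun n).continuous_deriv le_rfl) := rfl

/-- The weak eigenvalue equation. -/
lemma inner_dx_sineH (n : ℕ) (v : H01) :
    inner ℝ (sineH n).dx v.dx = eigval n * inner ℝ (sineL2 n) v.val := by
  have h := H01.inner_deriv_val (contDiff_deriv_sineFun n) v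
  rw [dx_sineH]
  have h2 : inner ℝ (contL2 (deriv (deriv (sineFun n)))
      ((contDiff_deriv_sineFun n).continuous_deriv le_rfl)) v.val =
      -eigval n * inner ℝ (sineL2 n) v.val := by
    rw [sineL2, inner_contL2, inner_contL2, ← intervalIntegral.integral_const_mul]
    congr 1; ext x; rw [deriv_deriv_sineFun]; ring
  rw [h2] at h
  linarith

lemma norm_sineL2 (n : ℕ) : ‖sineL2 n‖ = 1 := by
  rw [← sq_eq_sq₀ (norm_nonneg _) zero_le_one, ← real_inner_self_eq_norm_sq, sineL2, inner_contL2]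
  have h1 : ∫ x in (0:ℝ)..1, sineFun n x * contL2 (sineFun n) (contDiff_one_sineFun n).continuous x =
      ∫ x in (0:ℝ)..1, sineFun n x * sineFun n x := by
    rw [← integral_Ioo_eq_interval zero_le_one, ← integral_Ioo_eq_interval zero_le_one]
    refine integral_congr_ae ?_
    filter_upwards [coeFn_contL2 (sineFun n) (contDiff_one_sineFun n).continuous] with x hx
    rw [hx]
  rw [h1]
  have hf := (freq_pos n).ne'
  have hd : ∀ x ∈ uIcc (0:ℝ) 1, HasDerivAt
      (fun x => x - Real.sin (freq n * x) * Real.cos (freq n * x) / freq n)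
      (sineFun n x * sineFun n x) x := fun x _ => by
    have h1 := ((hasDerivAt_id x).const_mul (freq n)).sin
    have h2 := ((hasDerivAt_id x).const_mul (freq n)).cos
    convert! (hasDerivAt_id x).sub ((h1.mul h2).div_const (freq n)) using 1
    have := Real.sin_sq_add_cos_sq (freq n * x)
    simp only [sineFun, id]
    field_simp
    rw [show √2 ^ 2 = 2 by norm_num]
    linarith
  rw [intervalIntegral.integral_eq_sub_of_hasDerivAt hd]
  · simp [sin_freq]
  · exact ((contDiff_one_sineFun n).continuous.mul
      (contDiff_one_sineFun n).continuous).intervalIntegrable _ _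

/-- Orthogonality needs no trigonometric integral: the form `(u_x, v_x)` is symmetric and the
eigenvalues are distinct. -/
lemma orthonormal_sineL2 : Orthonormal ℝ sineL2 := by
  refine ⟨norm_sineL2, fun m n hmn => ?_⟩
  have h1 := inner_dx_sineH m (sineH n)
  have h2 := inner_dx_sineH n (sineH m)
  rw [real_inner_comm, h1, val_sineH, val_sineH, real_inner_comm (sineL2 n) (sineL2 m)] at h2
  change inner ℝ (sineL2 m) (sineL2 n) = 0
  rw [real_inner_comm]
  have h3 : (eigval m - eigval n) * inner ℝ (sineL2 n) (sineL2 m) = 0 := by linarith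
  exact (mul_eq_zero.1 h3).resolve_left (sub_ne_zero.2 fun h => hmn (eigval_injective h))

/-- Completeness of the sines by Weierstrass. Product-to-sum formulas make `sin(πx) f` orthogonal to
all polynomials in `cos(πx)`. These approximate every continuous function on `[0,1]` uniformly,
because `cos(πx)` is injective there. So `sin(πx) f = 0` a.e., and the sine is positive on `(0,1)`.
-/
lemma eq_zero_of_inner_sineL2_eq_zero {f : L2} (h : ∀ n, inner ℝ (sineL2 n) f = 0) : f = 0 := by
  have hint : ∀ {k : ℝ → ℝ}, Continuous k → IntervalIntegrable (fun x => k x * f x) volume 0 1 :=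
    fun hk => intervalIntegrable_of_integrable_Ioo
      ((memLp_of_continuous hk).integrable_mul (Lp.memLp f)) (by simp) (by simp)
  have h0 : ∀ n : ℕ, ∫ x in (0:ℝ)..1, Real.sin (n * (Real.pi * x)) * f x = 0 := fun n => by
    cases n with
    | zero => simp
    | succ n =>
      have h1 := h n
      rw [sineL2, inner_contL2] at h1
      have h2 : ∫ x in (0:ℝ)..1, √2 * (Real.sin (((n+1:ℕ):ℝ) * (Real.pi * x)) * f x) = 0 := by
        refine Eq.trans ?_ h1
        congr 1; ext x; simp only [sineFun, freq]; push_cast; ring_nf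
      rw [intervalIntegral.integral_const_mul] at h2
      exact (mul_eq_zero.1 h2).resolve_left (by positivity)
  have hcos : ∀ k n : ℕ,
      ∫ x in (0:ℝ)..1, Real.cos (Real.pi * x) ^ k * Real.sin (n * (Real.pi * x)) * f x = 0 := by
    intro k
    induction k with
    | zero => intro n; simpa using h0 n
    | succ k ih =>
      have hc : ∀ n : ℕ, Continuous fun x =>
        Real.cos (Real.pi * x) ^ k * Real.sin (n * (Real.pi * x)) := fun n => by fun_prop
      intro n
      cases n with
      | zero => simp
      | succ n =>
        have h1 : ∫ x in (0:ℝ)..1,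
            ((1 / 2) * (Real.cos (Real.pi * x) ^ k * Real.sin (((n + 2 : ℕ):ℝ) * (Real.pi * x)) * f x) +
            (1 / 2) * (Real.cos (Real.pi * x) ^ k * Real.sin (n * (Real.pi * x)) * f x)) = 0 := by
          rw [intervalIntegral.integral_add ((hint (hc _)).const_mul _) ((hint (hc _)).const_mul _),
            intervalIntegral.integral_const_mul, intervalIntegral.integral_const_mul, ih, ih]
          simp
        refine Eq.trans ?_ h1
        congr 1; ext x
        have e1 : ((n + 2 : ℕ) : ℝ) * (Real.pi * x) = ((n + 1 : ℕ) : ℝ) * (Real.pi * x) + Real.pi * x := by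
          push_cast; ring
        have e2 : (n : ℝ) * (Real.pi * x) = ((n + 1 : ℕ) : ℝ) * (Real.pi * x) - Real.pi * x := by
          push_cast; ring
        rw [e1, e2, Real.sin_add, Real.sin_sub]
        ring
  set h : ℝ → ℝ := fun x => Real.sin (Real.pi * x) * f x with hh
  have hhi : IntervalIntegrable h volume 0 1 := hint (by fun_prop)
  have hpoly : ∀ p : Polynomial ℝ, ∫ x in (0:ℝ)..1, p.eval (Real.cos (Real.pi * x)) * h x = 0 := by
    intro p
    have hi : ∀ p : Polynomial ℝ,
        IntervalIntegrable (fun x => p.eval (Real.cos (Real.pi * x)) * h x) volume 0 1 := fun p => by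
      have hc : Continuous fun x => p.eval (Real.cos (Real.pi * x)) :=
        p.continuous.comp (by fun_prop)
      exact hhi.continuousOn_mul hc.continuousOn
    induction p using Polynomial.induction_on' with
    | add p q hp hq =>
      simp only [Polynomial.eval_add, add_mul]
      rw [intervalIntegral.integral_add (hi p) (hi q), hp, hq, add_zero]
    | monomial n a =>
      have := hcos n 1
      simp only [Polynomial.eval_monomial, hh]
      have e : ∫ x in (0:ℝ)..1, a * (Real.cos (Real.pi * x) ^ n * Real.sin ((1:ℕ) * (Real.pi * x)) * f x) = 0 := by
        rw [intervalIntegral.integral_const_mul, this, mul_zero]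
      refine Eq.trans ?_ e
      congr 1; ext x; push_cast; ring_nf
  have hcont : ∀ φ : ℝ → ℝ, Continuous φ → ∫ x in (0:ℝ)..1, φ x * h x = 0 := by
    intro φ hφ
    have hK : 0 ≤ ∫ x in (0:ℝ)..1, |h x| :=
      intervalIntegral.integral_nonneg zero_le_one fun x _ => abs_nonneg _
    set K := ∫ x in (0:ℝ)..1, |h x|
    rw [← abs_eq_zero]
    refine le_antisymm (le_of_forall_pos_le_add fun ε hε => ?_) (abs_nonneg _)
    obtain ⟨p, hp⟩ := exists_polynomial_near_of_continuousOn (-1) 1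
      (fun y => φ (Real.arccos y / Real.pi))
      (hφ.comp (Real.continuous_arccos.div_const _)).continuousOn (ε / (K + 1)) (by positivity)
    have hpc : Continuous fun x => p.eval (Real.cos (Real.pi * x)) := p.continuous.comp (by fun_prop)
    have e : ∫ x in (0:ℝ)..1, φ x * h x =
        ∫ x in (0:ℝ)..1, (φ x * h x - p.eval (Real.cos (Real.pi * x)) * h x) := by
      rw [intervalIntegral.integral_sub (hhi.continuousOn_mul hφ.continuousOn)
        (hhi.continuousOn_mul hpc.continuousOn), hpoly, sub_zero]
    rw [e, zero_add]
    calc _ ≤ ∫ x in (0:ℝ)..1, |φ x * h x - p.eval (Real.cos (Real.pi * x)) * h x| :=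
          intervalIntegral.abs_integral_le_integral_abs zero_le_one
      _ ≤ ∫ x in (0:ℝ)..1, ε / (K + 1) * |h x| := by
          refine intervalIntegral.integral_mono_on zero_le_one ?_ (hhi.abs.const_mul _) ?_
          · exact ((hhi.continuousOn_mul hφ.continuousOn).sub
              (hhi.continuousOn_mul hpc.continuousOn)).abs
          · intro x hx
            rw [← sub_mul, abs_mul, abs_sub_comm]
            refine mul_le_mul_of_nonneg_right ?_ (abs_nonneg _)
            have := hp (Real.cos (Real.pi * x)) ⟨Real.neg_one_le_cos _, Real.cos_le_one _⟩
            rw [Real.arccos_cos (by have := hx.1; positivity)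
              (mul_le_of_le_one_right Real.pi_pos.le hx.2),
              mul_div_cancel_left₀ _ Real.pi_pos.ne'] at this
            exact this.le
      _ = ε / (K + 1) * K := intervalIntegral.integral_const_mul _ _
      _ ≤ ε := by
          rw [div_mul_eq_mul_div, div_le_iff₀ (by positivity)]
          nlinarith
  have hInt : Integrable h (intervalMeasure 0 1) :=
    (memLp_of_continuous (by fun_prop)).integrable_mul (Lp.memLp f)
  have key : ∀ᵐ x, x ∈ Ioo (0:ℝ) 1 → h x = 0 := by
    refine isOpen_Ioo.ae_eq_zero_of_integral_contDiff_smul_eq_zero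
      (IntegrableOn.locallyIntegrableOn hInt) fun g h1 h2 h3 => ?_
    rw [← setIntegral_eq_integral_of_forall_compl_eq_zero (s := Ioo (0:ℝ) 1)]
    · rw [integral_Ioo_eq_interval zero_le_one]
      exact hcont g h1.continuous
    · intro x hx
      have : g x = 0 := by by_contra h'; exact hx (h3 (subset_tsupport g h'))
      simp [this]
  rw [Lp.eq_zero_iff_ae_eq_zero]
  refine (ae_restrict_iff' measurableSet_Ioo).2 ?_
  filter_upwards [key] with x hx hx'
  have h1 : 0 < Real.sin (Real.pi * x) :=
    Real.sin_pos_of_pos_of_lt_pi (mul_pos Real.pi_pos hx'.1)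
      (mul_lt_of_lt_one_right Real.pi_pos hx'.2)
  exact (mul_eq_zero.1 (hx hx')).resolve_left h1.ne'

lemma orthogonal_span_eq_bot_of_forall {E ι : Type*} [NormedAddCommGroup E] [InnerProductSpace ℝ E]
    {v : ι → E} (h : ∀ x, (∀ i, inner ℝ (v i) x = 0) → x = 0) : (Submodule.span ℝ (range v))ᗮ = ⊥ := by
  rw [eq_bot_iff]
  intro x hx
  rw [Submodule.mem_orthogonal] at hx
  exact h x fun i => hx _ (Submodule.subset_span ⟨i, rfl⟩)

/-- The sines as a Hilbert basis of `L²(0,1)`. -/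
def sineBasis : HilbertBasis ℕ ℝ L2 :=
  HilbertBasis.mkOfOrthogonalEqBot orthonormal_sineL2
    (orthogonal_span_eq_bot_of_forall fun _ => eq_zero_of_inner_sineL2_eq_zero)

lemma coe_sineBasis : ⇑sineBasis = sineL2 := HilbertBasis.coe_mkOfOrthogonalEqBot _ _

lemma hasSum_inner_sineL2_mul (x y : L2) :
    HasSum (fun n => inner ℝ (sineL2 n) x * inner ℝ (sineL2 n) y) (inner ℝ x y) := by
  have := sineBasis.hasSum_inner_mul_inner x y
  rw [coe_sineBasis] at this
  simpa only [real_inner_comm x] using this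

lemma hasSum_inner_sineL2_sq (x : L2) : HasSum (fun n => inner ℝ (sineL2 n) x ^ 2) (‖x‖ ^ 2) := by
  simpa only [sq, real_inner_self_eq_norm_mul_norm] using hasSum_inner_sineL2_mul x x

lemma inner_sineH (n : ℕ) (v : H01) :
    inner ℝ (sineH n) v = (1 + eigval n) * inner ℝ (sineL2 n) v.val := by
  rw [H01.inner_eq, inner_dx_sineH, val_sineH]; ring

lemma inner_sineH_sineH (m n : ℕ) :
    inner ℝ (sineH m) (sineH n) = if m = n then 1 + eigval n else 0 := by
  rw [inner_sineH, val_sineH, orthonormal_iff_ite.1 orthonormal_sineL2]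
  split_ifs with h
  · rw [h, mul_one]
  · rw [mul_zero]

lemma one_add_eigval_pos (n : ℕ) : 0 < 1 + eigval n := by linarith [eigval_pos n]

lemma H01.inner_smul_left (c : ℝ) (u v : H01) : inner ℝ (c • u) v = c * inner ℝ u v := by
  rw [H01.inner_eq, H01.inner_eq, map_smul, map_smul, real_inner_smul_left, real_inner_smul_left]
  ring

lemma H01.inner_smul_right (c : ℝ) (u v : H01) : inner ℝ u (c • v) = c * inner ℝ u v := by
  rw [real_inner_comm, H01.inner_smul_left, real_inner_comm]

lemma orthonormal_sineH : Orthonormal ℝ fun n => (√(1 + eigval n))⁻¹ • sineH n := by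
  rw [orthonormal_iff_ite]
  intro m n
  rw [H01.inner_smul_left, H01.inner_smul_right, inner_sineH_sineH]
  split_ifs with h
  · subst h
    have := Real.sq_sqrt (one_add_eigval_pos m).le
    have h2 := Real.sqrt_pos.2 (one_add_eigval_pos m)
    field_simp
    linarith
  · simp

lemma inner_smul_sineH (n : ℕ) (v : H01) :
    inner ℝ ((√(1 + eigval n))⁻¹ • sineH n) v = √(1 + eigval n) * inner ℝ (sineL2 n) v.val := by
  have := Real.sq_sqrt (one_add_eigval_pos n).le
  have h2 := Real.sqrt_pos.2 (one_add_eigval_pos n)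
  rw [H01.inner_smul_left, inner_sineH, ← mul_assoc]
  congr 1
  field_simp
  linarith

/-- The sines as a Hilbert basis of `H₀¹(0,1)`. -/
def sineBasisH : HilbertBasis ℕ ℝ H01 :=
  HilbertBasis.mkOfOrthogonalEqBot orthonormal_sineH
    (orthogonal_span_eq_bot_of_forall fun v h => H01.val_injective
      (eq_zero_of_inner_sineL2_eq_zero fun n => by
        have := h n
        rw [inner_smul_sineH] at this
        exact (mul_eq_zero.1 this).resolve_left (Real.sqrt_pos.2 (one_add_eigval_pos n)).ne'))

lemma coe_sineBasisH : ⇑sineBasisH = fun n => (√(1 + eigval n))⁻¹ • sineH n :=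
  HilbertBasis.coe_mkOfOrthogonalEqBot _ _

/-- The Parseval identity in `H₀¹`, with weights `1 + eigval n`, minus the one in `L²`, with weights
`1`. -/
lemma hasSum_dx_sq (v : H01) :
    HasSum (fun n => eigval n * inner ℝ (sineL2 n) v.val ^ 2) (‖v.dx‖ ^ 2) := by
  have h1 := sineBasisH.hasSum_inner_mul_inner v v
  rw [coe_sineBasisH, real_inner_self_eq_norm_sq, H01.norm_sq] at h1
  have h2 := h1.sub (hasSum_inner_sineL2_sq v.val)
  rw [add_sub_cancel_left] at h2
  refine h2.congr_fun ?_ 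
  intro n
  have := Real.sq_sqrt (one_add_eigval_pos n).le
  simp only
  rw [real_inner_comm ((√(1 + eigval n))⁻¹ • sineH n) v, inner_smul_sineH]
  linear_combination (-inner ℝ (sineL2 n) v.val ^ 2) * this

lemma H01.ext_inner_sineL2 {u v : H01}
    (h : ∀ n, inner ℝ (sineL2 n) u.val = inner ℝ (sineL2 n) v.val) : u = v := by
  rw [← sub_eq_zero]
  refine H01.val_injective (eq_zero_of_inner_sineL2_eq_zero fun n => ?_)
  rw [map_sub, inner_sub_right, h, sub_self]

lemma norm_sum_smul_sineH_sq (s : Finset ℕ) (y : ℕ → ℝ) :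
    ‖∑ n ∈ s, y n • sineH n‖ ^ 2 = ∑ n ∈ s, (1 + eigval n) * y n ^ 2 := by
  rw [← real_inner_self_eq_norm_sq, sum_inner]
  refine Finset.sum_congr rfl fun n hn => ?_
  simp only [inner_sum, H01.inner_smul_left, H01.inner_smul_right, inner_sineH_sineH]
  rw [Finset.sum_eq_single n]
  · rw [if_pos rfl]; ring
  · intro m _ hm; rw [if_neg hm.symm]; ring
  · intro h; exact absurd hn h

/-! ### The scalar equation of a single mode. -/

/-- `y` is a Carathéodory solution of `y' = f - κ y` on `[a, b]`. -/
def IsMode (κ a b : ℝ) (f y : ℝ → ℝ) : Prop :=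
  ContinuousOn y (Icc a b) ∧ ∀ t ∈ Icc a b, y t = y a + ∫ s in a..t, (f s - κ * y s)

lemma memLp_of_continuousOn {a b : ℝ} {E : Type*} [NormedAddCommGroup E] {y : ℝ → E}
    (hy : ContinuousOn y (Icc a b)) : MemLp y 2 (intervalMeasure a b) := by
  obtain ⟨C, hC⟩ := isCompact_Icc.exists_bound_of_continuousOn hy
  refine MemLp.of_bound ?_ C ?_
  · exact (hy.mono Ioo_subset_Icc_self).aestronglyMeasurable measurableSet_Ioo
  filter_upwards [ae_restrict_mem measurableSet_Ioo] with x hx using hC x (Ioo_subset_Icc_self hx)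

lemma MemLp.mono_interval {E : Type*} [NormedAddCommGroup E] {a b s t : ℝ} {f : ℝ → E}
    (hf : MemLp f 2 (intervalMeasure a b)) (hs : a ≤ s) (ht : t ≤ b) :
    MemLp f 2 (intervalMeasure s t) :=
  hf.mono_measure (Measure.restrict_mono (Ioo_subset_Ioo hs ht) le_rfl)

lemma integrable_of_memLp_two {E : Type*} [NormedAddCommGroup E] {a b : ℝ} {f : ℝ → E}
    (hf : MemLp f 2 (intervalMeasure a b)) : Integrable f (intervalMeasure a b) :=
  hf.integrable (by norm_num)

namespace IsMode

variable {κ a b : ℝ} {f y : ℝ → ℝ}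

lemma memLp_rhs (h : IsMode κ a b f y) (hf : MemLp f 2 (intervalMeasure a b)) :
    MemLp (fun s => f s - κ * y s) 2 (intervalMeasure a b) :=
  hf.sub ((memLp_of_continuousOn h.1).const_mul κ)

lemma eq_add (h : IsMode κ a b f y) (hf : MemLp f 2 (intervalMeasure a b)) {s t : ℝ}
    (hs : s ∈ Icc a b) (ht : t ∈ Icc a b) : y t = y s + ∫ r in s..t, (f r - κ * y r) := by
  have hi := integrable_of_memLp_two (h.memLp_rhs hf)
  have ha : a ∈ Icc a b := ⟨le_rfl, hs.1.trans hs.2⟩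
  rw [h.2 t ht, h.2 s hs, add_assoc, intervalIntegral.integral_add_adjacent_intervals
    (intervalIntegrable_of_integrable_Ioo hi ha hs) (intervalIntegrable_of_integrable_Ioo hi hs ht)]

lemma sub {f₁ y₁ f₂ y₂ : ℝ → ℝ} (h₁ : IsMode κ a b f₁ y₁) (h₂ : IsMode κ a b f₂ y₂)
    (hf₁ : MemLp f₁ 2 (intervalMeasure a b)) (hf₂ : MemLp f₂ 2 (intervalMeasure a b)) :
    IsMode κ a b (fun s => f₁ s - f₂ s) (fun s => y₁ s - y₂ s) := by
  refine ⟨h₁.1.sub h₂.1, fun t ht => ?_⟩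
  have ha : a ∈ Icc a b := ⟨le_rfl, ht.1.trans ht.2⟩
  have e : ∀ s, f₁ s - f₂ s - κ * (y₁ s - y₂ s) = (f₁ s - κ * y₁ s) - (f₂ s - κ * y₂ s) :=
    fun s => by ring
  simp only [e]
  rw [intervalIntegral.integral_sub, h₁.2 t ht, h₂.2 t ht]
  · ring
  · exact intervalIntegrable_of_integrable_Ioo (integrable_of_memLp_two (h₁.memLp_rhs hf₁)) ha ht
  · exact intervalIntegrable_of_integrable_Ioo (integrable_of_memLp_two (h₂.memLp_rhs hf₂)) ha ht

lemma integral_rhs (h : IsMode κ a b f y) (hf : MemLp f 2 (intervalMeasure a b)) {s t : ℝ}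
    (hs : a ≤ s) (hst : s ≤ t) (ht : t ≤ b) :
    ∫ r in Ioo s t, (f r - κ * y r) = y t - y s := by
  rw [integral_Ioo_eq_interval hst, h.eq_add hf ⟨hs, hst.trans ht⟩ ⟨hs.trans hst, ht⟩]
  ring

lemma integral_mul_rhs (h : IsMode κ a b f y) (hf : MemLp f 2 (intervalMeasure a b)) {s t : ℝ}
    (hs : a ≤ s) (hst : s ≤ t) (ht : t ≤ b) :
    2 * ∫ r in Ioo s t, y r * (f r - κ * y r) = y t ^ 2 - y s ^ 2 := by
  have hi := integrable_of_memLp_two (h.memLp_rhs hf)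
  have hi' := intervalIntegrable_of_integrable_Ioo hi ⟨hs, hst.trans ht⟩ ⟨hs.trans hst, ht⟩
  have hy : ∀ x ∈ Icc s t, y x = y s + ∫ r in s..x, (f r - κ * y r) := fun x hx =>
    h.eq_add hf ⟨hs, hst.trans ht⟩ ⟨hs.trans hx.1, hx.2.trans ht⟩
  have := integral_parts_of_eq_add_integral hst hi' hy hi' hy
  rw [integral_Ioo_eq_interval hst, ← intervalIntegral.integral_const_mul, sq, sq, ← this]
  congr 1; ext x; ring

/-- With `g = f - κ y = y'`, one has `κ y g = c g + (f - c) g - g² ≤ c g + (f - c)²/4`; integrate.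
The free constant `c` later absorbs the frozen nonlinearity. -/
lemma energy_le (h : IsMode κ a b f y) (hf : MemLp f 2 (intervalMeasure a b)) {s t : ℝ}
    (hs : a ≤ s) (hst : s ≤ t) (ht : t ≤ b) (c : ℝ) :
    κ / 2 * (y t ^ 2 - y s ^ 2) ≤ c * (y t - y s) + 1 / 4 * ∫ r in Ioo s t, (f r - c) ^ 2 := by
  have hg := MemLp.mono_interval (h.memLp_rhs hf) hs ht
  have hy := MemLp.mono_interval (memLp_of_continuousOn h.1) hs ht
  have hfc : MemLp (fun r => f r - c) 2 (intervalMeasure s t) :=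
    (MemLp.mono_interval hf hs ht).sub (memLp_const c)
  rw [← h.integral_mul_rhs hf hs hst ht, ← h.integral_rhs hf hs hst ht]
  have e : κ / 2 * (2 * ∫ r in Ioo s t, y r * (f r - κ * y r)) =
      ∫ r in Ioo s t, κ * (y r * (f r - κ * y r)) := by
    rw [integral_const_mul]; ring
  rw [e, ← integral_const_mul, ← integral_const_mul, ← integral_add]
  · refine integral_mono ((hy.integrable_mul hg).const_mul κ) ?_ fun r => ?_
    · exact ((integrable_of_memLp_two hg).const_mul c).add (hfc.integrable_sq.const_mul _)
    · simp only
      nlinarith [sq_nonneg ((f r - κ * y r) - (f r - c) / 2)]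
  · exact (integrable_of_memLp_two hg).const_mul c
  · exact hfc.integrable_sq.const_mul _

/-- Cauchy–Schwarz in time, combined with `g² ≤ f² - κ (y²)'` for `g = y' = f - κ y`. -/
lemma sq_sub_le (h : IsMode κ a b f y) (hf : MemLp f 2 (intervalMeasure a b)) {s t : ℝ}
    (hs : a ≤ s) (hst : s ≤ t) (ht : t ≤ b) :
    (y t - y s) ^ 2 ≤ (t - s) * ((∫ r in Ioo s t, f r ^ 2) - κ * (y t ^ 2 - y s ^ 2)) := by
  have hg := MemLp.mono_interval (h.memLp_rhs hf) hs ht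
  have hy := MemLp.mono_interval (memLp_of_continuousOn h.1) hs ht
  have hf' := MemLp.mono_interval hf hs ht
  rcases hst.eq_or_lt with rfl | hlt
  · simp
  have h1 : ∫ r in Ioo s t, (f r - κ * y r) ^ 2 ≤
      (∫ r in Ioo s t, f r ^ 2) - κ * (y t ^ 2 - y s ^ 2) := by
    rw [← h.integral_mul_rhs hf hs hst ht, ← mul_assoc, ← integral_const_mul, ← integral_sub]
    · refine integral_mono hg.integrable_sq ?_ fun r => ?_
      · exact hf'.integrable_sq.sub ((hy.integrable_mul hg).const_mul _)
      · simp only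
        nlinarith [sq_nonneg (κ * y r)]
    · exact hf'.integrable_sq
    · exact (hy.integrable_mul hg).const_mul _
  -- Cauchy–Schwarz as nonnegativity of a variance: `m` is the mean of `y'` over `[s, t]`.
  set m := (y t - y s) / (t - s)
  have h2 : 0 ≤ ∫ r in Ioo s t, ((f r - κ * y r) - m) ^ 2 := integral_nonneg fun r => sq_nonneg _
  have h3 : ∫ r in Ioo s t, ((f r - κ * y r) - m) ^ 2 =
      (∫ r in Ioo s t, (f r - κ * y r) ^ 2) - 2 * m * (y t - y s) + m ^ 2 * (t - s) := by
    have e : ∀ r, ((f r - κ * y r) - m) ^ 2 = (f r - κ * y r) ^ 2 - 2 * m * (f r - κ * y r) + m ^ 2 :=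
      fun r => by ring
    simp only [e]
    rw [integral_add, integral_sub, integral_const_mul, h.integral_rhs hf hs hst ht]
    · simp [hst]; ring
    · exact hg.integrable_sq
    · exact (integrable_of_memLp_two hg).const_mul _
    · exact hg.integrable_sq.sub ((integrable_of_memLp_two hg).const_mul _)
    · exact integrable_const _
  have hpos : 0 < t - s := sub_pos.2 hlt
  have h4 : m * (t - s) = y t - y s := div_mul_cancel₀ _ hpos.ne'
  refine le_trans ?_ (mul_le_mul_of_nonneg_left h1 hpos.le)
  rw [h3] at h2
  have := mul_nonneg hpos.le h2
  rw [← h4] at this ⊢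
  nlinarith

lemma eqOn {y₁ y₂ : ℝ → ℝ} (hκ : 0 < κ) (h₁ : IsMode κ a b f y₁) (h₂ : IsMode κ a b f y₂)
    (hf : MemLp f 2 (intervalMeasure a b)) (h0 : y₁ a = y₂ a) : EqOn y₁ y₂ (Icc a b) := by
  intro t ht
  have := (h₁.sub h₂ hf hf).energy_le (hf.sub hf) le_rfl ht.1 ht.2 0
  simp only [sub_self, h0] at this
  simp only [integral_zero, ne_eq, OfNat.ofNat_ne_zero, not_false_eq_true, zero_pow] at this
  have h2 : (y₁ t - y₂ t) ^ 2 = 0 := by nlinarith [sq_nonneg (y₁ t - y₂ t)]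
  exact sub_eq_zero.1 (pow_eq_zero_iff two_ne_zero |>.1 h2)

/-- Since `f` is only integrable, split `y = P + v` with `P` the primitive of `f`. Then `v' = -κ (P
+ v)` has continuous data and is solved by an integrating factor. -/
lemma exists_of_integrable (hf : Integrable f (intervalMeasure a b)) (κ y₀ : ℝ) :
    ∃ y, Continuous y ∧ y a = y₀ ∧ IsMode κ a b f y := by
  set F : ℝ → ℝ := (Ioo a b).indicator f with hF
  have hFi : Integrable F := (integrable_indicator_iff measurableSet_Ioo).2 hf
  set P : ℝ → ℝ := fun t => ∫ s in a..t, F s with hP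
  have hPc : Continuous P := intervalIntegral.continuous_primitive (fun _ _ => hFi.intervalIntegrable) a
  set v : ℝ → ℝ := fun t =>
    Real.exp (-κ * (t - a)) * (y₀ - κ * ∫ s in a..t, Real.exp (κ * (s - a)) * P s) with hv
  have hc : Continuous fun s => Real.exp (κ * (s - a)) * P s := by fun_prop
  have hd : ∀ t, HasDerivAt v (-κ * (P t + v t)) t := fun t => by
    have h1 : HasDerivAt (fun t => ∫ s in a..t, Real.exp (κ * (s - a)) * P s)
        (Real.exp (κ * (t - a)) * P t) t :=
      intervalIntegral.integral_hasDerivAt_right (hc.intervalIntegrable _ _)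
        (hc.stronglyMeasurableAtFilter _ _) hc.continuousAt
    have h2 : HasDerivAt (fun t => Real.exp (-κ * (t - a))) (Real.exp (-κ * (t - a)) * (-κ * 1)) t :=
      (((hasDerivAt_id t).sub_const a).const_mul (-κ)).exp
    have h3 := h2.mul ((h1.const_mul κ).const_sub y₀)
    convert! h3 using 1
    have h4 : Real.exp (-κ * (t - a)) * Real.exp (κ * (t - a)) = 1 := by
      rw [← Real.exp_add]; simp
    simp only [hv]
    linear_combination (κ * P t) * h4
  have hvc : Continuous v := continuous_iff_continuousAt.2 fun t => (hd t).continuousAt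
  refine ⟨fun t => P t + v t, hPc.add hvc, by simp [hP, hv], (hPc.add hvc).continuousOn, fun t ht => ?_⟩
  have h1 : v t - v a = ∫ s in a..t, -κ * (P s + v s) :=
    (intervalIntegral.integral_eq_sub_of_hasDerivAt (fun s _ => hd s)
      ((continuous_const.mul (hPc.add hvc)).intervalIntegrable _ _)).symm
  have h2 : ∫ s in a..t, (f s - κ * (P s + v s)) = ∫ s in a..t, (F s + -κ * (P s + v s)) := by
    rw [← integral_Ioo_eq_interval ht.1, ← integral_Ioo_eq_interval ht.1]
    refine setIntegral_congr_fun measurableSet_Ioo fun s hs => ?_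
    have : F s = f s := 
      indicator_of_mem (s := Ioo a b) ⟨hs.1, hs.2.trans_le ht.2⟩ f
    simp only [this]; ring
  have h3 : P a = 0 := by simp [hP]
  have h4 : Continuous fun s => -κ * (P s + v s) := by fun_prop
  rw [h2, intervalIntegral.integral_add hFi.intervalIntegrable (h4.intervalIntegrable _ _), ← h1]
  change P t + v t = P a + v a + (P t + (v t - v a))
  rw [h3]; ring

end IsMode

/-! ### Weak time derivatives with values in a dual space. -/

section Dual

variable {E H : Type*} [NormedAddCommGroup E] [NormedSpace ℝ E] [NormedAddCommGroup H]
  [InnerProductSpace ℝ H]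

lemma IsTestFunction.integrable_smul {F : Type*} [NormedAddCommGroup F] [NormedSpace ℝ F] {a b : ℝ}
    {η : ℝ → ℝ} (hη : IsTestFunction a b η) {k : ℝ → F} (hk : Integrable k (intervalMeasure a b)) :
    Integrable (fun t => η t • k t) (intervalMeasure a b) ∧
      Integrable (fun t => deriv η t • k t) (intervalMeasure a b) := by
  have hd : Continuous (deriv η) := hη.smooth.continuous_deriv (by exact_mod_cast le_top)
  obtain ⟨C, hC⟩ := hη.compact.exists_bound_of_continuous hη.smooth.continuous
  obtain ⟨D, hD⟩ := hη.compact.deriv.exists_bound_of_continuous hd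
  exact ⟨hk.bdd_smul C hη.smooth.continuous.aestronglyMeasurable (Filter.Eventually.of_forall hC),
    hk.bdd_smul D hd.aestronglyMeasurable (Filter.Eventually.of_forall hD)⟩

lemma memLp_innerSL_comp (A : E →L[ℝ] H) {a b : ℝ} {x : ℝ → H} (hx : MemLp x 2 (intervalMeasure a b)) :
    MemLp (fun t => ((innerSL ℝ (x t)).comp A : StrongDual ℝ E)) 2 (intervalMeasure a b) :=
  (((ContinuousLinearMap.compL ℝ E H ℝ).flip A).comp (innerSL ℝ)).comp_memLp' hx

lemma memLp_smul_innerSL_comp_add (A B : E →L[ℝ] H) (c : ℝ) {a b : ℝ} {x y : ℝ → H}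
    (hx : MemLp x 2 (intervalMeasure a b)) (hy : MemLp y 2 (intervalMeasure a b)) :
    MemLp (fun t => (c • (innerSL ℝ (x t)).comp A + (innerSL ℝ (y t)).comp B : StrongDual ℝ E)) 2
      (intervalMeasure a b) :=
  ((memLp_innerSL_comp A hx).const_smul c).add (memLp_innerSL_comp B hy)

lemma weak_deriv_apply {a b : ℝ} {η : ℝ → ℝ} (hη : IsTestFunction a b η) {φ g : ℝ → StrongDual ℝ E}
    (hφ : MemLp φ 2 (intervalMeasure a b)) (hg : MemLp g 2 (intervalMeasure a b))
    (h : ∫ t in Ioo a b, deriv η t • φ t = -∫ t in Ioo a b, η t • g t) (w : E) :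
    ∫ t in Ioo a b, deriv η t * φ t w = -∫ t in Ioo a b, η t * g t w := by
  have h1 := congrArg (fun F : StrongDual ℝ E => F w) h
  rwa [neg_apply,
      ContinuousLinearMap.integral_apply (hη.integrable_smul (integrable_of_memLp_two hφ)).2,
      ContinuousLinearMap.integral_apply (hη.integrable_smul (integrable_of_memLp_two hg)).1] at h1

lemma weak_deriv_of_apply {a b : ℝ} {η : ℝ → ℝ} (hη : IsTestFunction a b η)
    {φ g : ℝ → StrongDual ℝ E} (hφ : MemLp φ 2 (intervalMeasure a b))
    (hg : MemLp g 2 (intervalMeasure a b)) {S : Set E} (hS : Dense (Submodule.span ℝ S : Set E))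
    (h : ∀ w ∈ S, ∫ t in Ioo a b, deriv η t * φ t w = -∫ t in Ioo a b, η t * g t w) :
    ∫ t in Ioo a b, deriv η t • φ t = -∫ t in Ioo a b, η t • g t := by
  refine ContinuousLinearMap.ext_on hS fun w hw => ?_
  rw [neg_apply,
      ContinuousLinearMap.integral_apply (hη.integrable_smul (integrable_of_memLp_two hφ)).2,
      ContinuousLinearMap.integral_apply (hη.integrable_smul (integrable_of_memLp_two hg)).1]
  exact h w hw

end Dual

/-! ### The linear heat equation, mode by mode. -/

/-- Every Fourier sine coefficient of `u` solves the corresponding mode of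
`u_t = δ u_xx + f` on `[a, b]`. -/
def SolvesModes (δ a b : ℝ) (f : ℝ → L2) (u : ℝ → H01) : Prop :=
  ∀ n, IsMode (δ * eigval n) a b (fun t => inner ℝ (sineL2 n) (f t))
    (fun t => inner ℝ (sineL2 n) (u t).val)

lemma memLp_inner_sineL2 {a b : ℝ} {f : ℝ → L2} (hf : MemLp f 2 (intervalMeasure a b)) (n : ℕ) :
    MemLp (fun t => inner ℝ (sineL2 n) (f t)) 2 (intervalMeasure a b) :=
  (innerSL ℝ (sineL2 n)).comp_memLp' hf

/-- Bessel's inequality for finitely many modes, so that no infinite sum has to be exchanged with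
the time integral. -/
lemma sum_integral_inner_sineL2_sq_le {a b : ℝ} {f : ℝ → L2} (hf : MemLp f 2 (intervalMeasure a b))
    (s : Finset ℕ) :
    ∑ n ∈ s, ∫ r in Ioo a b, inner ℝ (sineL2 n) (f r) ^ 2 ≤ ∫ r in Ioo a b, ‖f r‖ ^ 2 := by
  rw [← integral_finsetSum]
  · refine integral_mono (integrable_finsetSum _ fun n _ => (memLp_inner_sineL2 hf n).integrable_sq)
      hf.norm.integrable_sq fun r => ?_
    exact sum_le_hasSum s (fun n _ => sq_nonneg _) (hasSum_inner_sineL2_sq (f r))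
  · exact fun n _ => (memLp_inner_sineL2 hf n).integrable_sq

namespace SolvesModes

variable {δ a b : ℝ} {f : ℝ → L2} {u : ℝ → H01}

/-- The energy inequality, with the forcing shifted by an arbitrary constant. -/
lemma energy_le (h : SolvesModes δ a b f u) (hf : MemLp f 2 (intervalMeasure a b)) {s t : ℝ}
    (hs : a ≤ s) (hst : s ≤ t) (ht : t ≤ b) (c : L2) :
    δ / 2 * (‖(u t).dx‖ ^ 2 - ‖(u s).dx‖ ^ 2) ≤
      inner ℝ c ((u t).val - (u s).val) + 1 / 4 * ∫ r in Ioo s t, ‖f r - c‖ ^ 2 := by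
  have h1 := (((hasSum_dx_sq (u t)).sub (hasSum_dx_sq (u s))).mul_left (δ / 2)).sub
    (hasSum_inner_sineL2_mul c ((u t).val - (u s).val))
  have hfc : MemLp (fun r => f r - c) 2 (intervalMeasure s t) :=
    (MemLp.mono_interval hf hs ht).sub (memLp_const c)
  rw [← sub_le_iff_le_add']
  refine hasSum_le_of_sum_le h1 fun S => ?_
  refine le_trans ?_ (mul_le_mul_of_nonneg_left (sum_integral_inner_sineL2_sq_le hfc S)
    (by norm_num))
  rw [Finset.mul_sum]
  refine Finset.sum_le_sum fun n _ => ?_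
  have h2 := (h n).energy_le (memLp_inner_sineL2 hf n) hs hst ht (inner ℝ (sineL2 n) c)
  simp only [inner_sub_right]
  linarith

/-- The second factor stands for `∫ ‖u_t‖²`. It is the increment of a single function of time, which
is what makes the errors in the energy estimate telescope. -/
lemma norm_sub_sq_le (h : SolvesModes δ a b f u) (hf : MemLp f 2 (intervalMeasure a b)) {s t : ℝ}
    (hs : a ≤ s) (hst : s ≤ t) (ht : t ≤ b) :
    ‖(u t).val - (u s).val‖ ^ 2 ≤
      (t - s) * ((∫ r in Ioo s t, ‖f r‖ ^ 2) - δ * (‖(u t).dx‖ ^ 2 - ‖(u s).dx‖ ^ 2)) := by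
  have h1 := (hasSum_inner_sineL2_sq ((u t).val - (u s).val)).add
    (((hasSum_dx_sq (u t)).sub (hasSum_dx_sq (u s))).mul_left ((t - s) * δ))
  have key := hasSum_le_of_sum_le (c := (t - s) * ∫ r in Ioo s t, ‖f r‖ ^ 2) h1 fun S => ?_
  · linarith
  refine le_trans ?_ (mul_le_mul_of_nonneg_left
    (sum_integral_inner_sineL2_sq_le (MemLp.mono_interval hf hs ht) S) (sub_nonneg.2 hst))
  rw [Finset.mul_sum]
  refine Finset.sum_le_sum fun n _ => ?_
  have h2 := (h n).sq_sub_le (memLp_inner_sineL2 hf n) hs hst ht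
  simp only [inner_sub_right]
  linarith

lemma sub {f₁ f₂ : ℝ → L2} {u₁ u₂ : ℝ → H01} (h₁ : SolvesModes δ a b f₁ u₁)
    (h₂ : SolvesModes δ a b f₂ u₂) (hf₁ : MemLp f₁ 2 (intervalMeasure a b))
    (hf₂ : MemLp f₂ 2 (intervalMeasure a b)) :
    SolvesModes δ a b (fun t => f₁ t - f₂ t) (fun t => u₁ t - u₂ t) := fun n => by
  simpa only [map_sub, inner_sub_right] using
    (h₁ n).sub (h₂ n) (memLp_inner_sineL2 hf₁ n) (memLp_inner_sineL2 hf₂ n)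

end SolvesModes

lemma one_le_eigval (n : ℕ) : 1 ≤ eigval n := by
  have h1 : 1 ≤ freq n := by
    unfold freq
    have := Real.pi_gt_three
    have h2 : (0:ℝ) ≤ n := n.cast_nonneg
    nlinarith
  exact one_le_pow₀ h1

/-- The mode-wise energy bound dominates the `H₀¹` contribution of each mode by a summable sequence
uniformly in time, so the sine series satisfies the Cauchy criterion in `C([a,b]; H₀¹)`. -/
lemma exists_solvesModes {δ a b : ℝ} (hδ : 0 < δ) (hab : a ≤ b) {f : ℝ → L2}
    (hf : MemLp f 2 (intervalMeasure a b)) (φ₀ : H01) :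
    ∃ u : C(Icc a b, H01), IccExtend hab u a = φ₀ ∧ SolvesModes δ a b f (IccExtend hab u) := by
  choose y hyc hya hy using fun n => IsMode.exists_of_integrable
    (integrable_of_memLp_two (memLp_inner_sineL2 hf n)) (δ * eigval n) (inner ℝ (sineL2 n) φ₀.val)
  -- Twice the energy bound with `c = 0`; the factor two pays for `1 + eigval n ≤ 2 * eigval n`.
  set B : ℕ → ℝ := fun n => 2 * (eigval n * inner ℝ (sineL2 n) φ₀.val ^ 2) +
    δ⁻¹ * ∫ r in Ioo a b, inner ℝ (sineL2 n) (f r) ^ 2 with hB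
  have hI : ∀ n, 0 ≤ ∫ r in Ioo a b, inner ℝ (sineL2 n) (f r) ^ 2 := fun n =>
    integral_nonneg fun r => sq_nonneg _
  have hBs : Summable B := ((hasSum_dx_sq φ₀).summable.mul_left 2).add
    ((summable_of_sum_le hI (sum_integral_inner_sineL2_sq_le hf)).mul_left _)
  have hyB : ∀ n, ∀ t ∈ Icc a b, (1 + eigval n) * y n t ^ 2 ≤ B n := fun n t ht => by
    have h1 := (hy n).energy_le (memLp_inner_sineL2 hf n) le_rfl ht.1 ht.2 0
    have h2 : ∫ r in Ioo a t, (inner ℝ (sineL2 n) (f r) - 0) ^ 2 ≤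
        ∫ r in Ioo a b, inner ℝ (sineL2 n) (f r) ^ 2 := by
      simp only [sub_zero]
      exact setIntegral_mono_set (memLp_inner_sineL2 hf n).integrable_sq
        (Filter.Eventually.of_forall fun r => sq_nonneg _) (Ioo_subset_Ioo_right ht.2).eventuallyLE
    rw [hya] at h1
    have h3 := one_le_eigval n
    have h4 : (1 + eigval n) * y n t ^ 2 ≤ 2 * (eigval n * y n t ^ 2) := by
      nlinarith [sq_nonneg (y n t)]
    refine h4.trans ?_
    have h5 : δ * (eigval n * y n t ^ 2) ≤ δ * (eigval n * inner ℝ (sineL2 n) φ₀.val ^ 2) +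
      1 / 2 * ∫ r in Ioo a b, inner ℝ (sineL2 n) (f r) ^ 2 := by linarith
    have h6 := mul_le_mul_of_nonneg_left h5 (inv_pos.2 hδ).le
    rw [mul_add, inv_mul_cancel_left₀ hδ.ne', inv_mul_cancel_left₀ hδ.ne'] at h6
    simp only [hB]
    have h7 := mul_nonneg (inv_pos.2 hδ).le (hI n)
    linarith
  set g : ℕ → C(Icc a b, H01) := fun n => ⟨fun t => y n t • sineH n, by
    have := (hyc n).comp (continuous_subtype_val (p := fun x => x ∈ Icc a b))
    exact this.smul continuous_const⟩ with hg
  have hsum : Summable g := by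
    rw [summable_iff_vanishing_norm]
    intro ε hε
    obtain ⟨s, hs⟩ := (summable_iff_vanishing_norm.1 hBs) (ε ^ 2 / 4) (by positivity)
    refine ⟨s, fun S hS => ?_⟩
    have h1 := (le_abs_self _).trans_lt (hs S hS)
    refine lt_of_le_of_lt (b := ε / 2) ?_ (by linarith)
    rw [ContinuousMap.norm_le _ (by positivity)]
    intro t
    rw [ContinuousMap.sum_apply]
    refine abs_le_of_sq_le_sq' ?_ (by positivity) |>.2
    change ‖∑ n ∈ S, y n t • sineH n‖ ^ 2 ≤ _
    rw [norm_sum_smul_sineH_sq]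
    refine (Finset.sum_le_sum fun n _ => hyB n t t.2).trans ?_
    linarith
  have hcoef : ∀ n, ∀ t : Icc a b, inner ℝ (sineL2 n) ((∑' m, g m) t).val = y n t := by
    intro n t
    let A : C(Icc a b, H01) →L[ℝ] ℝ :=
      ((innerSL ℝ (sineL2 n)).comp H01.val).comp (ContinuousMap.evalCLM ℝ t)
    have h1 : HasSum (fun m => A (g m)) (A (∑' m, g m)) := A.hasSum hsum.hasSum
    have h2 : ∀ m, A (g m) = if m = n then y n t else 0 := fun m => by
      change inner ℝ (sineL2 n) (H01.val (y m t • sineH m)) = _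
      rw [map_smul, val_sineH, real_inner_smul_right, orthonormal_iff_ite.1 orthonormal_sineL2]
      by_cases hmn : m = n
      · subst hmn; simp
      · rw [if_neg (Ne.symm hmn), if_neg hmn, mul_zero]
    simp only [h2] at h1
    exact h1.unique (hasSum_ite_eq n _)
  have hcoef' : ∀ n, ∀ t ∈ Icc a b,
      inner ℝ (sineL2 n) (IccExtend hab (∑' m, g m : C(Icc a b, H01)) t).val = y n t := fun n t ht => by
    rw [IccExtend_of_mem hab _ ht, hcoef]
  refine ⟨∑' n, g n, ?_, fun n => ?_⟩
  · refine H01.ext_inner_sineL2 fun n => ?_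
    rw [hcoef' n a (left_mem_Icc.2 hab), hya]
  · refine ⟨(hyc n).continuousOn.congr fun t ht => hcoef' n t ht, fun t ht => ?_⟩
    simp only
    rw [hcoef' n t ht, hcoef' n a (left_mem_Icc.2 hab), (hy n).2 t ht]
    congr 1
    refine intervalIntegral.integral_congr fun s hs => ?_
    rw [uIcc_of_le ht.1] at hs
    simp only
    rw [hcoef' n s ⟨hs.1, hs.2.trans ht.2⟩]

/-- `φ` is a weak solution of `φ_t = δ φ_xx + f` on `(a, b)`. -/
def IsWeakLinear (δ a b : ℝ) (f : ℝ → L2) (φ : ℝ → H01) : Prop :=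
  ∃ φt : ℝ → HNeg1, MemLp φt 2 (intervalMeasure a b) ∧ HasWeakTimeDeriv a b φ φt ∧
    ∀ v : H01, ∀ᵐ t ∂(intervalMeasure a b),
      φt t v + δ * inner ℝ (φ t).dx v.dx = inner ℝ (f t) v.val

section Linear

variable {δ a b : ℝ} {f : ℝ → L2} {u : ℝ → H01}

lemma dense_span_sineH : Dense (Submodule.span ℝ (range sineBasisH) : Set H01) := by
  rw [Submodule.dense_iff_topologicalClosure_eq_top]; exact sineBasisH.dense_span

lemma memLp_val (hu : ContinuousOn u (Icc a b)) :
    MemLp (fun t => (u t).val) 2 (intervalMeasure a b) :=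
  memLp_of_continuousOn (H01.val.continuous.comp_continuousOn hu)

lemma memLp_dx (hu : ContinuousOn u (Icc a b)) :
    MemLp (fun t => (u t).dx) 2 (intervalMeasure a b) :=
  memLp_of_continuousOn (H01.dx.continuous.comp_continuousOn hu)

lemma SolvesModes.isWeakLinear (hab : a ≤ b) (h : SolvesModes δ a b f u)
    (hf : MemLp f 2 (intervalMeasure a b)) (hu : ContinuousOn u (Icc a b)) :
    IsWeakLinear δ a b f u := by
  -- The weak time derivative is the functional `v ↦ -δ (u_x, v_x) + (f, v)`; its defining identity
  -- need only be checked on the sine basis.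
  have hut := memLp_smul_innerSL_comp_add H01.dx H01.val (-δ) (memLp_dx hu) hf
  refine ⟨_, hut, fun η hη => ?_, fun v => Filter.Eventually.of_forall fun t => ?_⟩
  · refine weak_deriv_of_apply hη (memLp_innerSL_comp H01.val (memLp_val hu)) hut dense_span_sineH ?_
    rintro _ ⟨n, rfl⟩
    have h1 := integral_deriv_test_mul hab hη
      (integrable_of_memLp_two ((h n).memLp_rhs (memLp_inner_sineL2 hf n))) (h n).2
    rw [coe_sineBasisH]
    have e1 : ∀ t, deriv η t * inner ℝ (u t).val ((√(1 + eigval n))⁻¹ • sineH n).val =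
        (√(1 + eigval n))⁻¹ * (deriv η t * inner ℝ (sineL2 n) (u t).val) := fun t => by
      rw [map_smul, real_inner_smul_right, val_sineH, real_inner_comm]; ring
    have e2 : ∀ t, η t * (-δ * inner ℝ (u t).dx ((√(1 + eigval n))⁻¹ • sineH n).dx +
        inner ℝ (f t) ((√(1 + eigval n))⁻¹ • sineH n).val) =
        (√(1 + eigval n))⁻¹ * (η t * (inner ℝ (sineL2 n) (f t) -
          δ * eigval n * inner ℝ (sineL2 n) (u t).val)) := fun t => by
      rw [map_smul, map_smul, real_inner_smul_right, real_inner_smul_right, val_sineH,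
        real_inner_comm (sineH n).dx, inner_dx_sineH, real_inner_comm (sineL2 n)]
      ring
    change ∫ t in Ioo a b, deriv η t * inner ℝ (u t).val ((√(1 + eigval n))⁻¹ • sineH n).val =
      -∫ t in Ioo a b, η t * (-δ * inner ℝ (u t).dx ((√(1 + eigval n))⁻¹ • sineH n).dx +
        inner ℝ (f t) ((√(1 + eigval n))⁻¹ • sineH n).val)
    simp only [e1, e2]
    rw [integral_const_mul, integral_const_mul, h1, mul_neg]
  · change -δ * inner ℝ (u t).dx v.dx + inner ℝ (f t) v.val + δ * inner ℝ (u t).dx v.dx = _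
    ring

lemma IsWeakLinear.solvesModes (h : IsWeakLinear δ a b f u)
    (hf : MemLp f 2 (intervalMeasure a b)) (hu : ContinuousOn u (Icc a b)) :
    SolvesModes δ a b f u := by
  intro n
  have hyc : ContinuousOn (fun t => inner ℝ (sineL2 n) (u t).val) (Icc a b) :=
    ((innerSL ℝ (sineL2 n)).comp H01.val).continuous.comp_continuousOn hu
  refine ⟨hyc, ?_⟩
  rcases lt_or_ge a b with hab | hab
  swap
  · intro t ht
    have : t = a := le_antisymm (ht.2.trans hab) ht.1
    simp [this]
  obtain ⟨φt, hφt, hw, heq⟩ := h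
  have hg : MemLp (fun s => inner ℝ (sineL2 n) (f s) - δ * eigval n * inner ℝ (sineL2 n) (u s).val)
      2 (intervalMeasure a b) :=
    (memLp_inner_sineL2 hf n).sub ((memLp_of_continuousOn hyc).const_mul _)
  refine eq_add_integral_of_weak hab hyc (integrable_of_memLp_two hg) fun η hη => ?_
  have h1 := weak_deriv_apply hη (memLp_innerSL_comp H01.val (memLp_val hu)) hφt (hw η hη) (sineH n)
  refine Eq.trans ?_ (h1.trans ?_)
  · refine integral_congr_ae (Filter.Eventually.of_forall fun t => ?_)
    change _ = deriv η t * inner ℝ (u t).val (sineH n).val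
    simp only
    rw [val_sineH, real_inner_comm]
  · congr 1
    refine integral_congr_ae ?_
    filter_upwards [heq (sineH n)] with t ht
    rw [real_inner_comm (sineH n).dx, inner_dx_sineH, val_sineH, real_inner_comm (sineL2 n)] at ht
    congr 1
    linarith

end Linear

/-! ### Telescoping of errors and Volterra fixed points. -/

/-- An additive bound up to second-order errors is an additive bound. -/
lemma sub_le_sub_of_forall_sub_le {a b C : ℝ} {D J : ℝ → ℝ}
    (h : ∀ s t, a ≤ s → s ≤ t → t ≤ b → D t - D s ≤ C * (t - s) * (J t - J s)) {t : ℝ}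
    (ht : t ∈ Icc a b) : D t ≤ D a := by
  have key : ∀ n : ℕ, D t - D a ≤ (C * (t - a) * (J t - J a)) * ((1:ℝ) / ((n:ℝ) + 1)) := by
    intro n
    -- On `n + 1` equal steps the errors telescope to `C k (J t - J a)`, which tends to zero with
    -- `k`.
    set k : ℝ := (t - a) / ((n:ℝ) + 1) with hk
    have hn : (0:ℝ) < (n:ℝ) + 1 := by positivity
    have hk0 : 0 ≤ k := div_nonneg (sub_nonneg.2 ht.1) hn.le
    have hkn : ((n:ℝ) + 1) * k = t - a := mul_div_cancel₀ _ hn.ne'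
    set p : ℕ → ℝ := fun i => a + i * k with hp
    have hend : p (n + 1) = t := by simp only [hp]; push_cast; linarith
    have hstart : p 0 = a := by simp [hp]
    have hstep : ∀ i, p (i + 1) - p i = k := fun i => by simp only [hp]; push_cast; ring
    have hmono : ∀ i ≤ n + 1, p i ≤ t := fun i hi => by
      rw [← hend]
      have : (i:ℝ) ≤ ((n + 1 : ℕ) : ℝ) := by exact_mod_cast hi
      simp only [hp]
      nlinarith
    have hge : ∀ i, a ≤ p i := fun i => by
      have : 0 ≤ (i:ℝ) * k := by positivity
      simp only [hp]; linarith
    have h1 : ∑ i ∈ Finset.range (n + 1), (D (p (i + 1)) - D (p i)) ≤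
        ∑ i ∈ Finset.range (n + 1), C * k * (J (p (i + 1)) - J (p i)) := by
      refine Finset.sum_le_sum fun i hi => ?_
      have hi' := Finset.mem_range.1 hi
      have := h (p i) (p (i + 1)) (hge i) (by linarith [hstep i]) ((hmono _ hi').trans ht.2)
      rwa [hstep] at this
    rw [Finset.sum_range_sub (fun i => D (p i)), ← Finset.mul_sum,
      Finset.sum_range_sub (fun i => J (p i)), hend, hstart] at h1
    refine h1.trans (le_of_eq ?_)
    rw [hk]; ring
  have hlim : Filter.Tendsto (fun n : ℕ => (C * (t - a) * (J t - J a)) * ((1:ℝ) / ((n:ℝ) + 1)))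
      Filter.atTop (nhds ((C * (t - a) * (J t - J a)) * 0)) :=
    tendsto_one_div_add_atTop_nhds_zero_nat.const_mul _
  have := ge_of_tendsto' hlim key
  linarith

/-- Iterating the integral inequality produces `(C (t - a))^n / n!`, so a high iterate contracts on
the whole interval, whatever its length; its unique fixed point is that of `Φ`. -/
lemma exists_unique_fixedPoint_of_volterra {X : Type*} [NormedAddCommGroup X] [CompleteSpace X]
    {a b C : ℝ} (hab : a ≤ b) (hC : 0 ≤ C) (Φ : C(Icc a b, X) → C(Icc a b, X))
    (h : ∀ u v, ∀ t : Icc a b, ‖Φ u t - Φ v t‖ ^ 2 ≤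
      C * ∫ r in Ioo a t, ‖IccExtend hab u r - IccExtend hab v r‖ ^ 2) :
    ∃! u, Φ u = u := by
  have hiter : ∀ n : ℕ, ∀ u v, ∀ t : Icc a b, ‖Φ^[n] u t - Φ^[n] v t‖ ^ 2 ≤
      (C * (t - a)) ^ n / n.factorial * dist u v ^ 2 := by
    intro n
    induction n with
    | zero =>
      intro u v t
      have : ‖u t - v t‖ ≤ dist u v := by
        rw [← dist_eq_norm]; exact ContinuousMap.dist_apply_le_dist t
      simpa using pow_le_pow_left₀ (norm_nonneg _) this 2
    | succ n ih =>
      intro u v t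
      rw [Function.iterate_succ_apply', Function.iterate_succ_apply']
      refine (h _ _ t).trans ?_
      have hcont : Continuous fun r => ‖IccExtend hab (Φ^[n] u) r - IccExtend hab (Φ^[n] v) r‖ ^ 2 :=
        (((Φ^[n] u).continuous.Icc_extend' (h := hab)).sub
          ((Φ^[n] v).continuous.Icc_extend' (h := hab))).norm.pow 2
      have hcont2 : Continuous fun r : ℝ => (C * (r - a)) ^ n / n.factorial * dist u v ^ 2 := by
        fun_prop
      have h1 : ∫ r in Ioo a t, ‖IccExtend hab (Φ^[n] u) r - IccExtend hab (Φ^[n] v) r‖ ^ 2 ≤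
          ∫ r in Ioo a (t:ℝ), (C * (r - a)) ^ n / n.factorial * dist u v ^ 2 := by
        rw [integral_Ioo_eq_interval t.2.1, integral_Ioo_eq_interval t.2.1]
        refine intervalIntegral.integral_mono_on t.2.1 (hcont.intervalIntegrable _ _)
          (hcont2.intervalIntegrable _ _) fun r hr => ?_
        have hr' : r ∈ Icc a b := ⟨hr.1, hr.2.trans t.2.2⟩
        rw [IccExtend_of_mem hab _ hr', IccExtend_of_mem hab _ hr']
        exact ih u v ⟨r, hr'⟩
      refine (mul_le_mul_of_nonneg_left h1 hC).trans (le_of_eq ?_)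
      have hd : ∀ r ∈ uIcc a (t:ℝ), HasDerivAt
          (fun r => C ^ n * (r - a) ^ (n + 1) / (n + 1).factorial * dist u v ^ 2)
          ((C * (r - a)) ^ n / n.factorial * dist u v ^ 2) r := fun r _ => by
        have h2 := ((((hasDerivAt_id r).sub_const a).pow (n + 1)).const_mul (C ^ n)).div_const
          ((n + 1).factorial : ℝ) |>.mul_const (dist u v ^ 2)
        convert! h2 using 1
        have h3 : ((n + 1).factorial : ℝ) = (n + 1) * n.factorial := by
          rw [Nat.factorial_succ]; push_cast; ring
        have h4 : (n.factorial : ℝ) ≠ 0 := by positivity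
        have h5 : (n : ℝ) + 1 ≠ 0 := by positivity
        rw [h3, mul_pow]
        simp only [id, Nat.cast_add, Nat.cast_one, Nat.add_sub_cancel]
        field_simp
      rw [integral_Ioo_eq_interval t.2.1, intervalIntegral.integral_eq_sub_of_hasDerivAt hd
        (hcont2.intervalIntegrable _ _)]
      rw [sub_self, zero_pow (Nat.succ_ne_zero n), mul_pow]
      ring
  obtain ⟨n, hn⟩ : ∃ n : ℕ, (C * (b - a)) ^ n / n.factorial < (1 / 2) ^ 2 :=
    ((FloorSemiring.tendsto_pow_div_factorial_atTop (C * (b - a))).eventually_lt_const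
      (by norm_num)).exists
  have hcontr : ContractingWith (1 / 2) Φ^[n] := by
    refine ⟨by norm_num, LipschitzWith.of_dist_le_mul fun u v => ?_⟩
    rw [ContinuousMap.dist_le (by positivity)]
    intro t
    rw [dist_eq_norm]
    refine (abs_le_of_sq_le_sq' ?_ (by positivity)).2
    refine (hiter n u v t).trans ?_
    rw [mul_pow _ (dist u v)]
    refine mul_le_mul_of_nonneg_right ?_ (sq_nonneg _)
    refine le_trans ?_ (hn.le.trans (le_of_eq (by norm_num)))
    have h1 : 0 ≤ C * (t - a) := mul_nonneg hC (sub_nonneg.2 t.2.1)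
    have h2 : C * ((t:ℝ) - a) ≤ C * (b - a) :=
      mul_le_mul_of_nonneg_left (sub_le_sub_right t.2.2 a) hC
    gcongr
  have : Nonempty C(Icc a b, X) := ⟨0⟩
  refine ⟨hcontr.fixedPoint, hcontr.isFixedPt_fixedPoint_iterate, fun v hv => ?_⟩
  exact hcontr.fixedPoint_unique ((show Function.IsFixedPt Φ v from hv).iterate n)

/-! ### The truncated nonlinearity and its potential energy. -/

/-- The derivative of the double-well potential. -/
def force (y : ℝ) : ℝ := y ^ 3 - y

lemma deriv_V (y : ℝ) : deriv V y = force y := by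
  have h : HasDerivAt V ((1 / 4) * (2 * (y ^ 2 - 1) * (2 * y))) y := by
    have h1 := (((hasDerivAt_pow 2 y).sub_const 1).pow 2).const_mul (1 / 4 : ℝ)
    convert! h1 using 1
    norm_num
  rw [h.deriv, force]; ring

/-- Truncation to `[-M, M]`. -/
def clamp (M y : ℝ) : ℝ := max (-M) (min M y)

/-- The force, frozen outside `[-M, M]`. -/
def truncForce (M y : ℝ) : ℝ := force (clamp M y)

/-- The potential of `truncForce M`. -/
def truncPot (M y : ℝ) : ℝ := V (clamp M y) + force (clamp M y) * (y - clamp M y)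

lemma clamp_of_abs_le {M y : ℝ} (h : |y| ≤ M) : clamp M y = y := by
  rw [abs_le] at h
  rw [clamp, min_eq_right h.2, max_eq_right h.1]

lemma abs_clamp_le {M : ℝ} (hM : 0 ≤ M) (y : ℝ) : |clamp M y| ≤ M := by
  rw [clamp, abs_le]
  exact ⟨le_max_left _ _, max_le (by linarith) (min_le_left _ _)⟩

lemma abs_clamp_sub_le (M x y : ℝ) : |clamp M x - clamp M y| ≤ |x - y| := by
  refine (abs_max_sub_max_le_max _ _ _ _).trans ?_
  rw [sub_self, abs_zero, max_eq_right (abs_nonneg _)]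
  refine (abs_min_sub_min_le_max _ _ _ _).trans ?_
  rw [sub_self, abs_zero, max_eq_right (abs_nonneg _)]

lemma abs_force_sub_le {M p q : ℝ} (hp : |p| ≤ M) (hq : |q| ≤ M) :
    |force p - force q| ≤ (3 * M ^ 2 + 1) * |p - q| := by
  have e : force p - force q = (p ^ 2 + p * q + q ^ 2 - 1) * (p - q) := by unfold force; ring
  rw [e, abs_mul]
  refine mul_le_mul_of_nonneg_right ?_ (abs_nonneg _)
  have h1 : p ^ 2 ≤ M ^ 2 := sq_le_sq' (abs_le.1 hp).1 (abs_le.1 hp).2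
  have h2 : q ^ 2 ≤ M ^ 2 := sq_le_sq' (abs_le.1 hq).1 (abs_le.1 hq).2
  rw [abs_le]
  constructor <;> nlinarith [sq_nonneg (p + q), sq_nonneg (p - q)]

/-- A Lipschitz constant of `truncForce M`. -/
def lipConst (M : ℝ) : NNReal := ⟨3 * M ^ 2 + 1, by positivity⟩

lemma lipschitzWith_truncForce {M : ℝ} (hM : 0 ≤ M) : LipschitzWith (lipConst M) (truncForce M) := by
  refine LipschitzWith.of_dist_le_mul fun x y => ?_
  rw [Real.dist_eq, Real.dist_eq]
  exact (abs_force_sub_le (abs_clamp_le hM x) (abs_clamp_le hM y)).trans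
    (mul_le_mul_of_nonneg_left (abs_clamp_sub_le M x y) (lipConst M).2)

lemma truncForce_zero {M : ℝ} (hM : 0 ≤ M) : truncForce M 0 = 0 := by
  rw [truncForce, clamp_of_abs_le (by simpa using hM), force]; ring

lemma truncForce_of_abs_le {M y : ℝ} (h : |y| ≤ M) : truncForce M y = force y := by
  rw [truncForce, clamp_of_abs_le h]

lemma truncPot_of_abs_le {M y : ℝ} (h : |y| ≤ M) : truncPot M y = V y := by
  rw [truncPot, clamp_of_abs_le h]; ring

/-- For `M ≥ 1` the force at `±M` points outwards, so the affine extensions of `V` increase away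
from `[-M, M]`. -/
lemma truncPot_nonneg {M : ℝ} (hM : 1 ≤ M) (y : ℝ) : 0 ≤ truncPot M y := by
  have hV : ∀ z, 0 ≤ V z := fun z => by unfold V; positivity
  have hF : 0 ≤ force M := by
    have : force M = M * (M - 1) * (M + 1) := by unfold force; ring
    rw [this]
    exact mul_nonneg (mul_nonneg (by linarith) (by linarith)) (by linarith)
  have hF' : force (-M) = -force M := by unfold force; ring
  refine add_nonneg (hV _) ?_
  rcases le_total y M with h | h
  · rcases le_total (-M) y with h' | h'
    · rw [clamp_of_abs_le (abs_le.2 ⟨h', h⟩)]; simp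
    · have : clamp M y = -M := by rw [clamp, min_eq_right h, max_eq_left h']
      rw [this, hF']; nlinarith
  · have : clamp M y = M := by rw [clamp, min_eq_left h, max_eq_right (by linarith)]
    rw [this]; nlinarith

lemma force_sub_mul_le {M : ℝ} (hM : 0 ≤ M) (x y : ℝ) :
    (force (clamp M y) - force (clamp M x)) * (y - clamp M y) ≤ (3 * M ^ 2 + 1) * (y - x) ^ 2 := by
  by_cases hxy : clamp M x = clamp M y
  · rw [hxy, sub_self, zero_mul]; positivity
  -- If the clamps differ and `y` lies outside `[-M, M]`, then `clamp M y` lies between `x` and `y`.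
  have h1 : |y - clamp M y| ≤ |y - x| := by
    unfold clamp at hxy ⊢
    grind
  have h2 := abs_force_sub_le (abs_clamp_le hM y) (abs_clamp_le hM x)
  have h3 := abs_clamp_sub_le M y x
  calc _ ≤ |(force (clamp M y) - force (clamp M x)) * (y - clamp M y)| := le_abs_self _
    _ = |force (clamp M y) - force (clamp M x)| * |y - clamp M y| := abs_mul _ _
    _ ≤ ((3 * M ^ 2 + 1) * |y - x|) * |y - x| := by
      refine mul_le_mul (h2.trans (mul_le_mul_of_nonneg_left h3 (by positivity))) h1
        (abs_nonneg _) (by positivity)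
    _ = _ := by rw [mul_assoc, abs_mul_abs_self, ← sq]

/-- A second-order Taylor bound without differentiation. With `p`, `q` the clamps of `x`, `y`, the
remainder is `V q - V p - force p * (q - p)`, an explicit multiple of `(q - p)²`, plus the product
bounded in `force_sub_mul_le`. -/
lemma truncPot_sub_le {M : ℝ} (hM : 0 ≤ M) (x y : ℝ) :
    truncPot M y - truncPot M x ≤
      truncForce M x * (y - x) + 2 * (3 * M ^ 2 + 1) * (y - x) ^ 2 := by
  have h1 := force_sub_mul_le hM x y
  unfold truncPot truncForce
  have hp := abs_clamp_le hM x
  have hq := abs_clamp_le hM y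
  have h3 := sq_le_sq.2 (abs_clamp_sub_le M y x)
  set p := clamp M x
  set q := clamp M y
  have h4 : p ^ 2 ≤ M ^ 2 := sq_le_sq' (abs_le.1 hp).1 (abs_le.1 hp).2
  have h5 : q ^ 2 ≤ M ^ 2 := sq_le_sq' (abs_le.1 hq).1 (abs_le.1 hq).2
  have h2 : V q - V p - force p * (q - p) ≤ (3 * M ^ 2 + 1) * (q - p) ^ 2 := by
    have e : V q - V p - force p * (q - p) =
        ((1 / 4) * (q ^ 2 + 2 * (p * q) + 3 * p ^ 2) - 1 / 2) * (q - p) ^ 2 := by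
      unfold V force; ring
    rw [e]
    refine mul_le_mul_of_nonneg_right ?_ (sq_nonneg _)
    nlinarith [sq_nonneg (p - q)]
  have h6 : (3 * M ^ 2 + 1) * (q - p) ^ 2 ≤ (3 * M ^ 2 + 1) * (y - x) ^ 2 :=
    mul_le_mul_of_nonneg_left h3 (by positivity)
  linarith

lemma continuous_truncPot (M : ℝ) : Continuous (truncPot M) := by
  unfold truncPot V force clamp; fun_prop

/-- The Nemytskii operator of `truncForce M` on `L²(0,1)`. -/
def nemytskii (M : ℝ) (hM : 0 ≤ M) (u : L2) : L2 :=
  (lipschitzWith_truncForce hM).compLp (truncForce_zero hM) u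

/-- The potential energy of the truncated problem. -/
def potEnergy (M : ℝ) (u : L2) : ℝ := ∫ x in Ioo (0:ℝ) 1, truncPot M (u x)

section

variable {M : ℝ} (hM : 0 ≤ M)

lemma coeFn_nemytskii (u : L2) :
    nemytskii M hM u =ᵐ[intervalMeasure 0 1] fun x => truncForce M (u x) :=
  (lipschitzWith_truncForce hM).coeFn_compLp (truncForce_zero hM) u

lemma norm_nemytskii_sub_le (u v : L2) :
    ‖nemytskii M hM u - nemytskii M hM v‖ ≤ (3 * M ^ 2 + 1) * ‖u - v‖ :=
  (lipschitzWith_truncForce hM).norm_compLp_sub_le (truncForce_zero hM) u v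

lemma continuous_nemytskii : Continuous (nemytskii M hM) :=
  (lipschitzWith_truncForce hM).continuous_compLp (truncForce_zero hM)

lemma integrable_truncPot (hM : 1 ≤ M) (u : L2) :
    Integrable (fun x => truncPot M (u x)) (intervalMeasure 0 1) := by
  have h0 : 0 ≤ M := by linarith
  have h1 : Integrable (fun x => 1 / 4 + 2 * (3 * M ^ 2 + 1) * u x ^ 2) (intervalMeasure 0 1) :=
    (integrable_const _).add ((Lp.memLp u).integrable_sq.const_mul _)
  refine h1.mono' ((continuous_truncPot M).comp_aestronglyMeasurable (Lp.aestronglyMeasurable u)) ?_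
  refine Filter.Eventually.of_forall fun x => ?_
  rw [Real.norm_of_nonneg (truncPot_nonneg hM _)]
  have h2 := truncPot_sub_le h0 0 (u x)
  rw [truncForce_zero h0, truncPot_of_abs_le (y := 0) (by simpa using h0)] at h2
  simp only [sub_zero, zero_mul, zero_add, V] at h2
  linarith

lemma potEnergy_nonneg (hM : 1 ≤ M) (u : L2) : 0 ≤ potEnergy M u :=
  integral_nonneg fun _ => truncPot_nonneg hM _

lemma potEnergy_sub_le (hM1 : 1 ≤ M) (u v : L2) :
    potEnergy M v - potEnergy M u ≤
      inner ℝ (nemytskii M hM u) (v - u) + 2 * (3 * M ^ 2 + 1) * ‖v - u‖ ^ 2 := by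
  rw [← real_inner_self_eq_norm_sq, inner_L2_eq, inner_L2_eq, potEnergy, potEnergy,
    ← integral_const_mul, ← integral_sub (integrable_truncPot hM1 v) (integrable_truncPot hM1 u),
    ← integral_add]
  · refine integral_mono_ae ((integrable_truncPot hM1 v).sub (integrable_truncPot hM1 u)) ?_ ?_
    · exact ((Lp.memLp _).integrable_mul (Lp.memLp _)).add
        (((Lp.memLp _).integrable_mul (Lp.memLp _)).const_mul _)
    · filter_upwards [coeFn_nemytskii hM u, Lp.coeFn_sub v u] with x h1 h2
      rw [h1, h2, Pi.sub_apply, ← sq]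
      exact truncPot_sub_le hM (u x) (v x)
  · exact (Lp.memLp _).integrable_mul (Lp.memLp _)
  · exact ((Lp.memLp _).integrable_mul (Lp.memLp _)).const_mul _

lemma potEnergy_eq {u : L2} (hu : ∀ᵐ x ∂(intervalMeasure 0 1), |u x| ≤ M) :
    potEnergy M u = 1 / 4 * (eLpNorm u 4 (intervalMeasure 0 1)).toReal ^ 4 - 1 / 2 * ‖u‖ ^ 2 + 1 / 4 := by
  have h4 : MemLp u 4 (intervalMeasure 0 1) := MemLp.of_bound (Lp.aestronglyMeasurable u) M hu
  have e4 : (eLpNorm u 4 (intervalMeasure 0 1)).toReal ^ 4 = ∫ x in Ioo (0:ℝ) 1, u x ^ 4 := by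
    have h := h4.eLpNorm_eq_integral_rpow_norm (by norm_num) (by norm_num)
    have hnn : 0 ≤ ∫ x in Ioo (0:ℝ) 1, u x ^ 4 := integral_nonneg fun x => by positivity
    have hint : ∫ x in Ioo (0:ℝ) 1, ‖u x‖ ^ (4 : ENNReal).toReal = ∫ x in Ioo (0:ℝ) 1, u x ^ 4 := by
      congr 1; ext x
      have : (4 : ENNReal).toReal = ((4:ℕ):ℝ) := by norm_num
      rw [this, Real.rpow_natCast, Real.norm_eq_abs, Even.pow_abs (by decide)]
    rw [hint] at h
    rw [h, ENNReal.toReal_ofReal (by positivity)]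
    have : ((4 : ENNReal).toReal)⁻¹ = ((4:ℕ):ℝ)⁻¹ := by norm_num
    rw [this]
    exact Real.rpow_inv_natCast_pow hnn (by norm_num)
  have i4 : Integrable (fun x => u x ^ 4) (intervalMeasure 0 1) := by
    refine (integrable_const (M ^ 4)).mono' ((Lp.aestronglyMeasurable u).pow 4) ?_
    filter_upwards [hu] with x hx
    rw [norm_pow]
    exact pow_le_pow_left₀ (norm_nonneg _) hx 4
  have i2 : Integrable (fun x => u x ^ 2) (intervalMeasure 0 1) := (Lp.memLp u).integrable_sq
  have e2 : ‖u‖ ^ 2 = ∫ x in Ioo (0:ℝ) 1, u x ^ 2 := by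
    rw [← real_inner_self_eq_norm_sq, inner_L2_eq]; congr 1; ext x; ring
  have e : potEnergy M u = ∫ x in Ioo (0:ℝ) 1, (1 / 4 * u x ^ 4 - 1 / 2 * u x ^ 2 + 1 / 4) := by
    refine integral_congr_ae ?_
    filter_upwards [hu] with x hx
    rw [truncPot_of_abs_le hx, V]; ring
  have i42 : Integrable (fun x => 1 / 4 * u x ^ 4 - 1 / 2 * u x ^ 2) (intervalMeasure 0 1) :=
    (i4.const_mul _).sub (i2.const_mul _)
  rw [e, e4, e2, integral_add i42 (integrable_const _),
    integral_sub (i4.const_mul _) (i2.const_mul _), integral_const_mul, integral_const_mul]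
  simp

end

/-! ### The truncated problem: well-posedness and energy estimate. -/

/-- The right-hand side `α - δ⁻¹ F(u)` of the equation, with truncated nonlinearity. -/
def forcing (δ M : ℝ) (hM : 0 ≤ M) (α : ℝ → L2) (u : ℝ → H01) (t : ℝ) : L2 :=
  α t - δ⁻¹ • nemytskii M hM (u t).val

variable {δ a b M : ℝ} {α : ℝ → L2}

lemma memLp_forcing (hM : 0 ≤ M) (hα : MemLp α 2 (intervalMeasure a b)) {u : ℝ → H01}
    (hu : ContinuousOn u (Icc a b)) : MemLp (forcing δ M hM α u) 2 (intervalMeasure a b) := by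
  have h1 : ContinuousOn (fun t => nemytskii M hM (u t).val) (Icc a b) :=
    (continuous_nemytskii hM).comp_continuousOn (H01.val.continuous.comp_continuousOn hu)
  exact hα.sub ((memLp_of_continuousOn h1).const_smul δ⁻¹)

lemma SolvesModes.eqOn (hδ : 0 < δ) {f : ℝ → L2} {u v : ℝ → H01} (hu : SolvesModes δ a b f u)
    (hv : SolvesModes δ a b f v) (hf : MemLp f 2 (intervalMeasure a b)) (h0 : u a = v a) :
    EqOn u v (Icc a b) := fun _ ht =>
  H01.ext_inner_sineL2 fun n => (hu n).eqOn (mul_pos hδ (eigval_pos n)) (hv n)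
    (memLp_inner_sineL2 hf n) (by rw [h0]) ht

/-- The energy inequality for the difference with `c = 0`, followed by the Poincaré inequality,
which gives `‖w‖² ≤ 2 ‖w_x‖²`. -/
lemma SolvesModes.norm_sub_sq_le_integral (hδ : 0 < δ) {f g : ℝ → L2} {u v : ℝ → H01}
    (hu : SolvesModes δ a b f u) (hv : SolvesModes δ a b g v)
    (hf : MemLp f 2 (intervalMeasure a b)) (hg : MemLp g 2 (intervalMeasure a b))
    (h0 : u a = v a) {t : ℝ} (ht : t ∈ Icc a b) :
    ‖u t - v t‖ ^ 2 ≤ δ⁻¹ * ∫ r in Ioo a t, ‖f r - g r‖ ^ 2 := by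
  have h1 := (hu.sub hv hf hg).energy_le (hf.sub hg) le_rfl ht.1 ht.2 0
  simp only [h0, sub_self, map_zero, norm_zero, inner_zero_left, sub_zero, zero_add] at h1
  have h2 := H01.norm_sq (u t - v t)
  have h3 := pow_le_pow_left₀ (norm_nonneg _) (H01.norm_val_le (u t - v t)) 2
  rw [h2, inv_mul_eq_div, le_div_iff₀ hδ]
  nlinarith

/-- Solutions are the fixed points of `u ↦` the linear solution with forcing computed from `u`; the
Lipschitz bound on the force makes this a Volterra map. -/
theorem exists_unique_truncated (hδ : 0 < δ) (hab : a ≤ b) (hM : 0 ≤ M)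
    (hα : MemLp α 2 (intervalMeasure a b)) (φ₀ : H01) :
    ∃! u : C(Icc a b, H01), IccExtend hab u a = φ₀ ∧
      SolvesModes δ a b (forcing δ M hM α (IccExtend hab u)) (IccExtend hab u) := by
  have hcont : ∀ u : C(Icc a b, H01), Continuous (IccExtend hab u) := fun u =>
    u.continuous.Icc_extend'
  have hmem : ∀ u : C(Icc a b, H01),
      MemLp (forcing δ M hM α (IccExtend hab u)) 2 (intervalMeasure a b) := fun u =>
    memLp_forcing hM hα (hcont u).continuousOn
  choose Φ hΦ0 hΦ using fun u : C(Icc a b, H01) => exists_solvesModes hδ hab (hmem u) φ₀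
  set L : ℝ := 3 * M ^ 2 + 1
  have hfix : ∀ u : C(Icc a b, H01), Φ u = u ↔ IccExtend hab u a = φ₀ ∧
      SolvesModes δ a b (forcing δ M hM α (IccExtend hab u)) (IccExtend hab u) := by
    refine fun u => ⟨fun h => ?_, fun h => ?_⟩
    · have h0 := hΦ0 u
      have h1 := hΦ u
      rw [h] at h0 h1
      exact ⟨h0, h1⟩
    · ext1 t
      have := (hΦ u).eqOn hδ h.2 (hmem u) ((hΦ0 u).trans h.1.symm) t.2
      rwa [IccExtend_of_mem hab _ t.2, IccExtend_of_mem hab _ t.2] at this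
  simp only [← hfix]
  refine exists_unique_fixedPoint_of_volterra hab (C := δ⁻¹ * (δ⁻¹ * L) ^ 2) (by positivity) Φ ?_
  intro u v t
  have h1 := (hΦ u).norm_sub_sq_le_integral hδ (hΦ v) (hmem u) (hmem v)
    ((hΦ0 u).trans (hΦ0 v).symm) t.2
  rw [IccExtend_of_mem hab _ t.2, IccExtend_of_mem hab _ t.2] at h1
  refine h1.trans ?_
  rw [mul_assoc]
  refine mul_le_mul_of_nonneg_left ?_ (inv_pos.2 hδ).le
  rw [← integral_const_mul]
  refine integral_mono ((MemLp.mono_interval ((hmem u).sub (hmem v)) le_rfl t.2.2).norm.integrable_sq)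
    ?_ fun r => ?_
  · have : MemLp (fun r => IccExtend hab u r - IccExtend hab v r) 2 (intervalMeasure a t) :=
      memLp_of_continuousOn ((hcont u).sub (hcont v)).continuousOn
    exact this.norm.integrable_sq.const_mul _
  · simp only [forcing]
    rw [sub_sub_sub_cancel_left, ← smul_sub, norm_smul, ← mul_pow, Real.norm_of_nonneg (inv_pos.2 hδ).le,
      mul_assoc]
    refine pow_le_pow_left₀ (by positivity) (mul_le_mul_of_nonneg_left ?_ (inv_pos.2 hδ).le) 2
    rw [norm_sub_rev]
    refine (norm_nemytskii_sub_le hM _ _).trans (mul_le_mul_of_nonneg_left ?_ (by positivity))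
    rw [← map_sub]
    have h2 := H01.norm_sq (IccExtend hab u r - IccExtend hab v r)
    have h3 := sq_nonneg ‖(IccExtend hab u r - IccExtend hab v r).dx‖
    exact (sq_le_sq₀ (norm_nonneg _) (norm_nonneg _)).1 (by rw [h2]; linarith)

lemma setIntegral_Ioo_sub {g : ℝ → ℝ} (hg : Integrable g (intervalMeasure a b)) {s t : ℝ}
    (hs : a ≤ s) (hst : s ≤ t) (ht : t ≤ b) :
    (∫ r in Ioo a t, g r) - ∫ r in Ioo a s, g r = ∫ r in Ioo s t, g r := by
  have ha : a ∈ Icc a b := ⟨le_rfl, hs.trans (hst.trans ht)⟩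
  rw [integral_Ioo_eq_interval (hs.trans hst), integral_Ioo_eq_interval hs,
    integral_Ioo_eq_interval hst, intervalIntegral.integral_interval_sub_left]
  · exact intervalIntegrable_of_integrable_Ioo hg ha ⟨hs.trans hst, ht⟩
  · exact intervalIntegrable_of_integrable_Ioo hg ha ⟨hs, hst.trans ht⟩

/-- The energy estimate for the truncated problem. -/
theorem truncated_energy_le (hδ : 0 < δ) (hM : 0 ≤ M) (hM1 : 1 ≤ M)
    (hα : MemLp α 2 (intervalMeasure a b)) {u : ℝ → H01} (hu : ContinuousOn u (Icc a b))
    (h : SolvesModes δ a b (forcing δ M hM α u) u) {t : ℝ} (ht : t ∈ Icc a b) :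
    δ / 2 * ‖(u t).dx‖ ^ 2 + δ⁻¹ * potEnergy M (u t).val ≤
      δ / 2 * ‖(u a).dx‖ ^ 2 + δ⁻¹ * potEnergy M (u a).val + 1 / 2 * ∫ r in Ioo a t, ‖α r‖ ^ 2 := by
  set f := forcing δ M hM α u with hf_def
  have hf : MemLp f 2 (intervalMeasure a b) := memLp_forcing hM hα hu
  have hδ' : 0 < δ⁻¹ := inv_pos.2 hδ
  set L : ℝ := 3 * M ^ 2 + 1 with hL
  have hL0 : 0 < L := by positivity
  -- `J` controls time increments: `‖u(t) - u(s)‖² ≤ (t - s) (J t - J s)` in `L²`. In particular it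
  -- is nondecreasing.
  set J : ℝ → ℝ := fun t => (∫ r in Ioo a t, ‖f r‖ ^ 2) - δ * ‖(u t).dx‖ ^ 2 with hJ
  set E : ℝ → ℝ := fun t => δ / 2 * ‖(u t).dx‖ ^ 2 + δ⁻¹ * potEnergy M (u t).val -
    1 / 2 * ∫ r in Ioo a t, ‖α r‖ ^ 2 with hE
  have hincr : ∀ s t, a ≤ s → s ≤ t → t ≤ b →
      ‖(u t).val - (u s).val‖ ^ 2 ≤ (t - s) * (J t - J s) := fun s t hs hst ht => by
    refine (h.norm_sub_sq_le hf hs hst ht).trans (le_of_eq ?_)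
    rw [← setIntegral_Ioo_sub hf.norm.integrable_sq hs hst ht]
    simp only [hJ]; ring
  have hJmono : ∀ s t, a ≤ s → s ≤ t → t ≤ b → J s ≤ J t := fun s t hs hst ht => by
    rcases hst.eq_or_lt with rfl | hlt
    · exact le_rfl
    · have h1 := (sq_nonneg _).trans (hincr s t hs hst ht)
      have h2 := nonneg_of_mul_nonneg_right h1 (sub_pos.2 hlt)
      linarith
  have hstep : ∀ s t, a ≤ s → s ≤ t → t ≤ b →
      E t - E s ≤ (1 / 2 * (δ⁻¹ * L) ^ 2 * (b - a) + δ⁻¹ * (2 * L)) * (t - s) * (J t - J s) := by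
    intro s t hs hst ht
    have hJst := sub_nonneg.2 (hJmono s t hs hst ht)
    have hts := sub_nonneg.2 hst
    -- Freezing the nonlinearity at time `s` makes `(c, u(t) - u(s))` cancel the first-order change
    -- of the potential energy. Then `f - c` is `α` plus a Lipschitz error, and `‖x - y‖² ≤ 2‖x‖² +
    -- 2‖y‖²` turns `1/4` into the coefficient `1/2` of `∫ ‖α‖²`.
    set c : L2 := -(δ⁻¹ • nemytskii M hM (u s).val) with hc
    have h1 := h.energy_le hf hs hst ht c
    have h2 := potEnergy_sub_le hM hM1 (u s).val (u t).val
    have h3 := hincr s t hs hst ht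
    have hα' := MemLp.mono_interval hα hs ht
    have hpt : ∀ r ∈ Ioo s t, ‖f r - c‖ ^ 2 ≤
        2 * ‖α r‖ ^ 2 + 2 * ((δ⁻¹ * L) ^ 2 * ((t - s) * (J t - J s))) := by
      intro r hr
      have e : f r - c = α r - δ⁻¹ • (nemytskii M hM (u r).val - nemytskii M hM (u s).val) := by
        simp only [hf_def, forcing, hc, smul_sub]; abel
      have e1 : ‖δ⁻¹ • (nemytskii M hM (u r).val - nemytskii M hM (u s).val)‖ ^ 2 ≤
          (δ⁻¹ * L) ^ 2 * ((t - s) * (J t - J s)) := by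
        rw [norm_smul, Real.norm_of_nonneg hδ'.le]
        have e2 := mul_le_mul_of_nonneg_left (norm_nemytskii_sub_le hM (u r).val (u s).val) hδ'.le
        refine (pow_le_pow_left₀ (by positivity) e2 2).trans ?_
        rw [← mul_assoc, mul_pow (δ⁻¹ * (3 * M ^ 2 + 1))]
        refine mul_le_mul_of_nonneg_left ?_ (sq_nonneg _)
        have hrb := hr.2.le.trans ht
        refine (hincr s r hs hr.1.le hrb).trans ?_
        have := hJmono r t (hs.trans hr.1.le) hr.2.le ht
        exact mul_le_mul (by linarith [hr.2]) (by linarith)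
          (sub_nonneg.2 (hJmono s r hs hr.1.le hrb)) hts
      rw [e]
      have e3 := norm_sub_le (α r) (δ⁻¹ • (nemytskii M hM (u r).val - nemytskii M hM (u s).val))
      have e4 := pow_le_pow_left₀ (norm_nonneg _) e3 2
      nlinarith [sq_nonneg (‖α r‖ -
        ‖δ⁻¹ • (nemytskii M hM (u r).val - nemytskii M hM (u s).val)‖)]
    have h4 : ∫ r in Ioo s t, ‖f r - c‖ ^ 2 ≤ 2 * (∫ r in Ioo s t, ‖α r‖ ^ 2) +
        2 * ((δ⁻¹ * L) ^ 2 * ((t - s) * (J t - J s))) * (t - s) := by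
      have hfc : MemLp (fun r => f r - c) 2 (intervalMeasure s t) :=
        (MemLp.mono_interval hf hs ht).sub (memLp_const c)
      refine (setIntegral_mono_on hfc.norm.integrable_sq ?_ measurableSet_Ioo hpt).trans (le_of_eq ?_)
      · exact (hα'.norm.integrable_sq.const_mul 2).add (integrable_const _)
      · rw [integral_add (hα'.norm.integrable_sq.const_mul 2) (integrable_const _),
          integral_const_mul]
        simp [hst]; ring
    have h5 := setIntegral_Ioo_sub hα.norm.integrable_sq hs hst ht
    have h6 : inner ℝ c ((u t).val - (u s).val) =
        -(δ⁻¹ * inner ℝ (nemytskii M hM (u s).val) ((u t).val - (u s).val)) := by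
      rw [hc, inner_neg_left, real_inner_smul_left]
    rw [h6] at h1
    have h7 := mul_le_mul_of_nonneg_left h2 hδ'.le
    have h8 : (t - s) * ((t - s) * (J t - J s)) ≤ (b - a) * ((t - s) * (J t - J s)) :=
      mul_le_mul_of_nonneg_right (by linarith) (mul_nonneg hts hJst)
    have h9 := mul_le_mul_of_nonneg_left h8 (by positivity : 0 ≤ 1 / 2 * (δ⁻¹ * L) ^ 2)
    have h10 := mul_le_mul_of_nonneg_left h3 (by positivity : 0 ≤ δ⁻¹ * (2 * L))
    simp only [hE]
    rw [← hL] at h7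
    linarith
  have key := sub_le_sub_of_forall_sub_le hstep ht
  simp only [hE, Ioo_self, setIntegral_empty, mul_zero, sub_zero] at key
  linarith

/-! ### Removing the truncation. -/

/-- As long as `|u| ≤ M`, the truncation is not seen. -/
lemma isWeakSolution_iff_truncated {T : ℝ} (hT : a ≤ T) (hM : 0 ≤ M) (α : Control a T)
    (φ₀ : H01) (u : C(Icc a T, H01)) (hu : ∀ t, ‖(u t).dx‖ ≤ M) :
    IsWeakSolution δ a T α φ₀ (IccExtend hT u) ↔ IccExtend hT u a = φ₀ ∧
      SolvesModes δ a T (forcing δ M hM α (IccExtend hT u)) (IccExtend hT u) := by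
  set w := IccExtend hT u with hw
  have hc : ContinuousOn w (Icc a T) := (u.continuous.Icc_extend' (h := hT)).continuousOn
  have hf := memLp_forcing (δ := δ) hM (Lp.memLp α) hc
  have hrhs : ∀ t ∈ Ioo a T, ∀ v : H01,
      ∫ x in Ioo (0 : ℝ) 1, (-δ⁻¹ * deriv V ((w t).val x) + α t x) * v.val x =
        inner ℝ (forcing δ M hM α w t) v.val := by
    intro t ht v
    rw [inner_L2_eq]
    refine integral_congr_ae ?_
    have hb : ‖(w t).dx‖ ≤ M := by
      rw [hw, IccExtend_of_mem hT _ (Ioo_subset_Icc_self ht)]; exact hu _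
    filter_upwards [(w t).ae_abs_val_le, coeFn_nemytskii hM (w t).val,
      Lp.coeFn_sub (α t) (δ⁻¹ • nemytskii M hM (w t).val),
      Lp.coeFn_smul δ⁻¹ (nemytskii M hM (w t).val)] with x h1 h2 h3 h4
    rw [forcing, h3, Pi.sub_apply, h4, Pi.smul_apply, h2, truncForce_of_abs_le (h1.trans hb), deriv_V,
      smul_eq_mul]
    ring
  have hiff : (∃ φt : ℝ → HNeg1, MemLp φt 2 (intervalMeasure a T) ∧ HasWeakTimeDeriv a T w φt ∧
      ∀ v : H01, ∀ᵐ t ∂(intervalMeasure a T), φt t v + δ * inner ℝ (w t).dx v.dx =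
        ∫ x in Ioo (0 : ℝ) 1, (-δ⁻¹ * deriv V ((w t).val x) + α t x) * v.val x) ↔
      IsWeakLinear δ a T (forcing δ M hM α w) w := by
    refine exists_congr fun φt => and_congr_right fun _ => and_congr_right fun _ =>
      forall_congr' fun v => Filter.eventually_congr ?_
    filter_upwards [ae_restrict_mem measurableSet_Ioo] with t ht
    rw [hrhs t ht v]
  rw [IsWeakSolution, hiff]
  exact ⟨fun h => ⟨h.2.2, h.2.1.solvesModes hf hc⟩,
    fun h => ⟨memLp_of_continuousOn hc, h.2.isWeakLinear hT hf hc, h.1⟩⟩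

lemma norm_control_sq {T : ℝ} (α : Control a T) : ‖α‖ ^ 2 = ∫ r in Ioo a T, ‖α r‖ ^ 2 := by
  rw [← real_inner_self_eq_norm_sq, L2.inner_def]
  simp only [real_inner_self_eq_norm_sq]

end GinzburgLandau

end

theorem mainTheorem12 (δ t₀ T : ℝ) (hδ : 0 < δ) (hT : t₀ ≤ T)
    (φ₀ : GinzburgLandau.H01) (α : GinzburgLandau.Control t₀ T) :
    ∃ φ : C(Set.Icc t₀ T, GinzburgLandau.H01),
      GinzburgLandau.IsWeakSolution δ t₀ T α φ₀ (Set.IccExtend hT φ) ∧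
      (∀ ψ : C(Set.Icc t₀ T, GinzburgLandau.H01),
        GinzburgLandau.IsWeakSolution δ t₀ T α φ₀ (Set.IccExtend hT ψ) → ψ = φ) ∧
      ∀ t : Set.Icc t₀ T,
        ‖(φ t).dx‖ ^ 2 ≤
          ‖φ₀.dx‖ ^ 2
            + δ⁻¹ ^ 2 / 2 *
              (MeasureTheory.eLpNorm φ₀.val 4 (GinzburgLandau.intervalMeasure 0 1)).toReal ^ 4
            - δ⁻¹ ^ 2 * ‖φ₀.val‖ ^ 2 + δ⁻¹ * ‖α‖ ^ 2 + δ⁻¹ ^ 2 / 2 := by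
  open GinzburgLandau in
  have hδ' : 0 < δ⁻¹ := inv_pos.2 hδ
  set R : ℝ := ‖φ₀.dx‖ ^ 2 + δ⁻¹ ^ 2 / 2 *
      (MeasureTheory.eLpNorm φ₀.val 4 (GinzburgLandau.intervalMeasure 0 1)).toReal ^ 4
      - δ⁻¹ ^ 2 * ‖φ₀.val‖ ^ 2 + δ⁻¹ * ‖α‖ ^ 2 + δ⁻¹ ^ 2 / 2 with hR
  -- `R` does not depend on `M`, so there is no circularity. The three entries make the truncated
  -- potential nonnegative, the initial energy untruncated, and the truncation inactive along the
  -- solution.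
  set M : ℝ := max 1 (max ‖φ₀.dx‖ √R)
  have hM1 : 1 ≤ M := le_max_left _ _
  have hM : 0 ≤ M := zero_le_one.trans hM1
  have hφ₀M : ‖φ₀.dx‖ ≤ M := (le_max_left _ _).trans (le_max_right _ _)
  have hRM : √R ≤ M := (le_max_right _ _).trans (le_max_right _ _)
  have hα := MeasureTheory.Lp.memLp α
  obtain ⟨φ, ⟨hφ0, hφ⟩, -⟩ := exists_unique_truncated hδ hT hM hα φ₀
  have hbound : ∀ t : Set.Icc t₀ T, ‖(φ t).dx‖ ^ 2 ≤ R := by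
    intro t
    have h1 := truncated_energy_le hδ hM hM1 hα
      (φ.continuous.Icc_extend' (h := hT)).continuousOn hφ t.2
    rw [hφ0, Set.IccExtend_of_mem hT _ t.2, potEnergy_eq (φ₀.ae_abs_val_le.mono fun x hx => hx.trans hφ₀M)]
      at h1
    -- The potential energy at time `t` is simply dropped from the left-hand side.
    have h2 := mul_nonneg hδ'.le (potEnergy_nonneg hM1 (φ t).val)
    have h3 : ∫ r in Set.Ioo t₀ (t:ℝ), ‖α r‖ ^ 2 ≤ ‖α‖ ^ 2 := by
      rw [norm_control_sq]
      exact MeasureTheory.setIntegral_mono_set hα.norm.integrable_sq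
        (Filter.Eventually.of_forall fun r => sq_nonneg _)
        (Set.Ioo_subset_Ioo_right t.2.2).eventuallyLE
    have h4 : δ / 2 * ‖(φ t).dx‖ ^ 2 ≤ δ / 2 * R := by
      have e : δ / 2 * R = δ / 2 * ‖φ₀.dx‖ ^ 2 + (δ * δ⁻¹) * δ⁻¹ * (1 / 4 *
        (MeasureTheory.eLpNorm φ₀.val 4 (GinzburgLandau.intervalMeasure 0 1)).toReal ^ 4
          - 1 / 2 * ‖φ₀.val‖ ^ 2 + 1 / 4) + 1 / 2 * (δ * δ⁻¹) * ‖α‖ ^ 2 := by rw [hR]; ring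
      rw [e, mul_inv_cancel₀ hδ.ne']
      linarith
    exact le_of_mul_le_mul_left h4 (by positivity)
  have hφM : ∀ t, ‖(φ t).dx‖ ≤ M := fun t => (Real.le_sqrt_of_sq_le (hbound t)).trans hRM
  have hφw := (isWeakSolution_iff_truncated (δ := δ) hT hM α φ₀ φ hφM).2 ⟨hφ0, hφ⟩
  refine ⟨φ, hφw, fun ψ hψ => ?_, hbound⟩
  have hdx : ∀ (u : C(Set.Icc t₀ T, H01)) t, ‖(u t).dx‖ ≤ ‖u‖ := fun u t => by
    refine le_trans ?_ (u.norm_coe_le_norm t)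
    have := H01.norm_sq (u t)
    exact (sq_le_sq₀ (norm_nonneg _) (norm_nonneg _)).1 (by
      rw [this]; linarith [sq_nonneg ‖(u t).val‖])
  -- An arbitrary competitor has no a priori bound by `M`, so the truncation level is chosen anew
  -- from the sup norms of both solutions. Well-posedness only needs it to be nonnegative.
  have hN : 0 ≤ max ‖φ‖ ‖ψ‖ := (norm_nonneg φ).trans (le_max_left _ _)
  exact (exists_unique_truncated hδ hT hN hα φ₀).unique
    ((isWeakSolution_iff_truncated hT hN α φ₀ ψ fun t => (hdx ψ t).trans (le_max_right _ _)).1 hψ)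
    ((isWeakSolution_iff_truncated hT hN α φ₀ φ fun t => (hdx φ t).trans (le_max_left _ _)).1 hφw)
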